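/- Let $n\ge 2$ and let $\ell=(\ell_1,\dots,\ell_n)$ be a length vector with $0<\ell_1\le\dots\le\ell_n$. For $J\subset\{1,\dots,n\}$ say that $J$ is short (with respect to $\ell$) if $\sum_{j\in J}\ell_j<\sum_{j\notin J}\ell_j$, and long if its complement is short. Assume that $\ell$ is generic, i.e. every $J$ is short or long. Let $\mathcal M_\ell=\{(z_1,\dots,z_{n-1})\in (S^1)^{n-1} : \sum_{i=1}^{n-1}\ell_iz_i+\ell_n=0\}$ be the planar polygon space (with the last side rotated to direction $1$), and for $t\in[0,\ell_1)$ put $\ell_t=(\ell_1-t,\ell_2,\dots,\ell_{n-1},\ell_n+t)$. Let $0<\varepsilon<\ell_1$ be so small that a subset $J\subset\{1,\dots,n\}$ is short with respect to $\ell_{\ell_1-\varepsilon}$ if and only if $s(J\setminus\{1\})$ is short with respect to $\ell'=(\ell_2,\dots,\ell_{n-1},\ell_n+\ell_1)$, where $s(i)=i-1$. (This holds for all sufficiently small $\varepsilon>0$.) Let $$W=\Big\{(z_2,\dots,z_{n-1},t)\in (S^1)^{n-2}\times[0,\ell_1-\varepsilon] : \Big|\sum_{i=2}^{n-1}\ell_iz_i+\ell_n+t\Big|^2=(\ell_1-t)^2\Big\}.$$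 Then $W$ is a compact smooth $(n-2)$-dimensional cobordism between $\mathcal M_\ell$ and $\mathcal M_{\ell_{\ell_1-\varepsilon}}$: it is a compact smooth submanifold with boundary of $\mathbb C^{n-2}\times\mathbb R$, whose boundary is the disjoint union of $V_0$ and $V_{\ell_1-\varepsilon}$, where $V_t=\{(z_2,\dots,z_{n-1},t) : (z_1,\dots,z_{n-1})\in\mathcal M_{\ell_t}\}$, and $V_0$ and $V_{\ell_1-\varepsilon}$ are diffeomorphic to $\mathcal M_\ell$ and $\mathcal M_{\ell_{\ell_1-\varepsilon}}$. The map $g:W\to[0,\ell_1-\varepsilon]$, $g(z,t)=t$, is a Morse function on this cobordism, that is, it is smooth, $g^{-1}(0)=V_0$, $g^{-1}(\ell_1-\varepsilon)=V_{\ell_1-\varepsilon}$, and all its critical points are nondegenerate and lie in the interior of $W$. Its critical points are in one-to-one correspondence with the subsets $J\subset\{2,\dots,n-1\}$ which are short with respect to $\ell$ and for which $\{1\}\cup J$ is long with respect to $\ell$. The critical point corresponding to such $J$ is $$q_J=(u_2,\dots,u_{n-1},t),$$ where $u_j=-1$ for $j\in J$ and $u_j=1$ for $j\in\{1,\dots,n\}\setminus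 J$, and $t$ is determined by $$2t\Big(\sum_{j=1}^nu_j\ell_j\Big)=\ell_1^2-\Big(\sum_{j=2}^nu_j\ell_j\Big)^2,\qquad \sum_{j=1}^nu_j\ell_j\neq0.$$ The index of $q_J$ is $|J|$. -/

import Mathlib

open scoped ContDiff

/-! ### Smooth submanifolds with boundary of a normed space, and Morse functions on them -/

/-- The model domains in `ℝ^d`: the whole space, or a half-space `{x | 0 ≤ x i}`. -/
def IsModelDomain {d : ℕ} (H : Set (Fin d → ℝ)) : Prop :=
  H = Set.univ ∨ ∃ i : Fin d, H = {x | 0 ≤ x i}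

/-- `φ`, restricted to the relatively open subset `O ∩ H` of a model domain `H` in `ℝ^d`, is a
diffeomorphism onto a relatively open subset of `X ⊆ E`, sending `x` to `p`. Smoothness of the
map and of its inverse `ψ` means, as usual for subsets of vector spaces, that they are restrictions
of smooth maps defined on open sets. -/
structure IsLocalParamAt {E : Type*} [NormedAddCommGroup E] [NormedSpace ℝ E] {d : ℕ}
    (X : Set E) (p : E) (H O : Set (Fin d → ℝ)) (φ : (Fin d → ℝ) → E) (x : Fin d → ℝ) :
    Prop where
  model : IsModelDomain H
  isOpen : IsOpen O
  contDiffOn : ContDiffOn ℝ ∞ φ O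
  exists_inverse : ∃ (V : Set E) (ψ : E → (Fin d → ℝ)), IsOpen V ∧ φ '' (O ∩ H) = X ∩ V ∧
    ContDiffOn ℝ ∞ ψ V ∧ ∀ y ∈ O ∩ H, ψ (φ y) = y
  mem : x ∈ O ∩ H
  map_eq : φ x = p

/-- `X ⊆ E` is a smooth `d`-dimensional submanifold with (possibly empty) boundary. -/
def IsSmoothSubmanifold {E : Type*} [NormedAddCommGroup E] [NormedSpace ℝ E] (d : ℕ)
    (X : Set E) : Prop :=
  ∀ p ∈ X, ∃ (H O : Set (Fin d → ℝ)) (φ : (Fin d → ℝ) → E) (x : Fin d → ℝ),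
    IsLocalParamAt X p H O φ x

/-- The boundary of a smooth `d`-dimensional submanifold with boundary: the points that correspond,
in a local parametrization by a half-space, to a point of the bounding hyperplane. -/
def manifoldBoundary {E : Type*} [NormedAddCommGroup E] [NormedSpace ℝ E] (d : ℕ)
    (X : Set E) : Set E :=
  {p | ∃ (i : Fin d) (O : Set (Fin d → ℝ)) (φ : (Fin d → ℝ) → E) (x : Fin d → ℝ),
    IsLocalParamAt X p {y | 0 ≤ y i} O φ x ∧ x i = 0}

/-- `p` is a critical point of `g|X`: the differential of `g` vanishes at `p` in a (equivalently,
in every) local parametrization of `X` around `p`. -/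
def IsCriticalPt {E : Type*} [NormedAddCommGroup E] [NormedSpace ℝ E] (d : ℕ)
    (X : Set E) (g : E → ℝ) (p : E) : Prop :=
  ∃ (H O : Set (Fin d → ℝ)) (φ : (Fin d → ℝ) → E) (x : Fin d → ℝ),
    IsLocalParamAt X p H O φ x ∧ fderiv ℝ (g ∘ φ) x = 0

/-- The Hessian bilinear form at `x` of a function `h` on `ℝ^d`. -/
noncomputable def hessianAt {d : ℕ} (h : (Fin d → ℝ) → ℝ) (x : Fin d → ℝ) :
    LinearMap.BilinForm ℝ (Fin d → ℝ) :=
  (fderiv ℝ (fderiv ℝ h) x).toBilinForm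

/-- `p` is a nondegenerate critical point of `g|X`: its Hessian in a (equivalently, in every) local
parametrization is a nondegenerate bilinear form. -/
def IsNondegenerateCriticalPt {E : Type*} [NormedAddCommGroup E] [NormedSpace ℝ E] (d : ℕ)
    (X : Set E) (g : E → ℝ) (p : E) : Prop :=
  ∃ (H O : Set (Fin d → ℝ)) (φ : (Fin d → ℝ) → E) (x : Fin d → ℝ),
    IsLocalParamAt X p H O φ x ∧ fderiv ℝ (g ∘ φ) x = 0 ∧ (hessianAt (g ∘ φ) x).Nondegenerate

/-- `p` is a critical point of `g|X` of Morse index `k`: in a (equivalently, in every) local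
parametrization, `k` is the maximal dimension of a subspace on which the Hessian is negative
definite. -/
def HasMorseIndex {E : Type*} [NormedAddCommGroup E] [NormedSpace ℝ E] (d : ℕ)
    (X : Set E) (g : E → ℝ) (p : E) (k : ℕ) : Prop :=
  ∃ (H O : Set (Fin d → ℝ)) (φ : (Fin d → ℝ) → E) (x : Fin d → ℝ),
    IsLocalParamAt X p H O φ x ∧ fderiv ℝ (g ∘ φ) x = 0 ∧
      sigNeg (hessianAt (g ∘ φ) x).toQuadraticMap = k

/-- The subsets `A ⊆ E` and `B ⊆ F` are diffeomorphic. -/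
def AreDiffeomorphic {E F : Type*} [NormedAddCommGroup E] [NormedSpace ℝ E]
    [NormedAddCommGroup F] [NormedSpace ℝ F] (A : Set E) (B : Set F) : Prop :=
  ∃ (S : E → F) (T : F → E) (U : Set E) (V : Set F), IsOpen U ∧ A ⊆ U ∧ ContDiffOn ℝ ∞ S U ∧
    IsOpen V ∧ B ⊆ V ∧ ContDiffOn ℝ ∞ T V ∧ Set.MapsTo S A B ∧ Set.MapsTo T B A ∧
    Set.LeftInvOn T S A ∧ Set.RightInvOn T S B

/-- `X` is a compact smooth `d`-dimensional manifold with boundary the disjoint union of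
`V₀` and `V₁`. -/
structure IsCompactCobordism {E : Type*} [NormedAddCommGroup E] [NormedSpace ℝ E] (d : ℕ)
    (X V₀ V₁ : Set E) : Prop where
  isCompact : IsCompact X
  submanifold : IsSmoothSubmanifold d X
  boundary_eq : manifoldBoundary d X = V₀ ∪ V₁
  disjoint : Disjoint V₀ V₁

/-- `g : X → [a, b]` is a Morse function on the cobordism `(X; V₀, V₁)`: it is smooth, its
preimages of `a` and `b` are `V₀` and `V₁`, and all its critical points are nondegenerate and lie
in the interior. -/
structure IsMorseFunction {E : Type*} [NormedAddCommGroup E] [NormedSpace ℝ E] (d : ℕ)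
    (X V₀ V₁ : Set E) (g : E → ℝ) (a b : ℝ) : Prop where
  cobordism : IsCompactCobordism d X V₀ V₁
  smooth : ∃ U : Set E, IsOpen U ∧ X ⊆ U ∧ ContDiffOn ℝ ∞ g U
  mapsTo : Set.MapsTo g X (Set.Icc a b)
  preimage_left : X ∩ g ⁻¹' {a} = V₀
  preimage_right : X ∩ g ⁻¹' {b} = V₁
  interior : ∀ p, IsCriticalPt d X g p → p ∉ manifoldBoundary d X
  nondegenerate : ∀ p, IsCriticalPt d X g p → IsNondegenerateCriticalPt d X g p

/-! ### Length vectors and planar polygon spaces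

A length vector with `n = m + 2` entries `ℓ_1, …, ℓ_n` is a function `ℓ : Fin (m + 2) → ℝ`; its
first entry is `ℓ 0`, its last entry is `ℓ (Fin.last (m + 1))`. -/

/-- `J` is short with respect to `ℓ`. -/
def IsShort {k : ℕ} (ℓ : Fin k → ℝ) (J : Finset (Fin k)) : Prop :=
  ∑ j ∈ J, ℓ j < ∑ j ∈ Jᶜ, ℓ j

/-- `J` is long with respect to `ℓ`. -/
def IsLong {k : ℕ} (ℓ : Fin k → ℝ) (J : Finset (Fin k)) : Prop :=
  IsShort ℓ Jᶜ

/-- `ℓ` is generic: it lies on none of the hyperplanes `∑_{j ∈ J} ℓ_j = ∑_{j ∉ J} ℓ_j`. -/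
def IsGenericLength {k : ℕ} (ℓ : Fin k → ℝ) : Prop :=
  ∀ J : Finset (Fin k), ∑ j ∈ J, ℓ j ≠ ∑ j ∈ Jᶜ, ℓ j

/-- The planar polygon space, normalized by rotating the last coordinate to `1`: the configurations
`(z_1, …, z_{n-1})` on the torus with `ℓ_1 z_1 + ⋯ + ℓ_{n-1} z_{n-1} + ℓ_n = 0`. -/
def polygonSpace {m : ℕ} (ℓ : Fin (m + 2) → ℝ) : Set (Fin (m + 1) → ℂ) :=
  {z | (∀ i, ‖z i‖ = 1) ∧
    ∑ i : Fin (m + 1), (ℓ i.castSucc : ℂ) * z i + (ℓ (Fin.last (m + 1)) : ℂ) = 0}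

/-- `ℓ_t = (ℓ_1 - t, ℓ_2, …, ℓ_{n-1}, ℓ_n + t)`. -/
noncomputable def shiftLength {m : ℕ} (ℓ : Fin (m + 2) → ℝ) (t : ℝ) : Fin (m + 2) → ℝ :=
  fun i => if i = 0 then ℓ 0 - t
    else if i = Fin.last (m + 1) then ℓ (Fin.last (m + 1)) + t else ℓ i

/-- `ℓ' = (ℓ_2, …, ℓ_{n-1}, ℓ_n + ℓ_1)`. -/
noncomputable def mergeLength {m : ℕ} (ℓ : Fin (m + 2) → ℝ) : Fin (m + 1) → ℝ :=
  fun i => if i = Fin.last m then ℓ (Fin.last (m + 1)) + ℓ 0 else ℓ i.succ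

/-- `ε ∈ (0, ℓ_1)` is so small that `J ⊆ {1, …, n}` is short with respect to `ℓ_{ℓ_1 - ε}` if and
only if `s (J - {1})` is short with respect to `ℓ'`, where `s i = i - 1`. -/
def IsSmallEnough {m : ℕ} (ℓ : Fin (m + 2) → ℝ) (ε : ℝ) : Prop :=
  0 < ε ∧ ε < ℓ 0 ∧ ∀ J : Finset (Fin (m + 2)),
    IsShort (shiftLength ℓ (ℓ 0 - ε)) J ↔
      IsShort (mergeLength ℓ) (Finset.univ.filter fun i : Fin (m + 1) => i.succ ∈ J)

/-- The inclusion of `{2, …, n-1}`, which is indexed by `Fin m`, in `{1, …, n}`. -/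
def mid {m : ℕ} (j : Fin m) : Fin (m + 2) := j.succ.castSucc

/-- The function
`f (z_2, …, z_{n-1}, t) = ‖ℓ_2 z_2 + ⋯ + ℓ_{n-1} z_{n-1} + ℓ_n + t‖ ^ 2 - (ℓ_1 - t) ^ 2`. -/
noncomputable def cobordismFun {m : ℕ} (ℓ : Fin (m + 2) → ℝ) (p : (Fin m → ℂ) × ℝ) : ℝ :=
  ‖∑ j : Fin m, (ℓ (mid j) : ℂ) * p.1 j + (ℓ (Fin.last (m + 1)) : ℂ) + (p.2 : ℂ)‖ ^ 2 -
    (ℓ 0 - p.2) ^ 2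

/-- `W`, the zero set of `cobordismFun ℓ` in `T^{n-2} × [0, ℓ_1 - ε]`. -/
def cobordismW {m : ℕ} (ℓ : Fin (m + 2) → ℝ) (ε : ℝ) : Set ((Fin m → ℂ) × ℝ) :=
  {p | (∀ j, ‖p.1 j‖ = 1) ∧ p.2 ∈ Set.Icc 0 (ℓ 0 - ε) ∧ cobordismFun ℓ p = 0}

/-- The copy `{(z_2, …, z_{n-1}, t) | (z_1, …, z_{n-1}) ∈ M_{ℓ_t}}` of the polygon space of `ℓ_t`
at height `t`. -/
def polygonSlice {m : ℕ} (ℓ : Fin (m + 2) → ℝ) (t : ℝ) : Set ((Fin m → ℂ) × ℝ) :=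
  (fun z : Fin (m + 1) → ℂ => ((fun j : Fin m => z j.succ), t)) '' polygonSpace (shiftLength ℓ t)

/-- The subsets `J ⊆ {2, …, n-1}` that are short and for which `{1} ∪ J` is long. -/
def criticalSets {m : ℕ} (ℓ : Fin (m + 2) → ℝ) : Set (Finset (Fin m)) :=
  {J | IsShort ℓ (J.image mid) ∧ IsLong ℓ (insert 0 (J.image mid))}

/-- The signs `u_1, …, u_n` of `J`: `u_j = -1` for `j ∈ J` and `u_j = 1` otherwise. -/
def signOf {m : ℕ} (J : Finset (Fin m)) (i : Fin (m + 2)) : ℝ :=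
  if i ∈ J.image mid then -1 else 1

/-- The collinear configuration `q_J = (u_2, …, u_{n-1}, t)`, where `t` is the solution of
`2 t (∑_{j=1}^n u_j ℓ_j) = ℓ_1 ^ 2 - (∑_{j=2}^n u_j ℓ_j) ^ 2`. -/
noncomputable def criticalConfig {m : ℕ} (ℓ : Fin (m + 2) → ℝ) (J : Finset (Fin m)) :
    (Fin m → ℂ) × ℝ :=
  (fun j => (signOf J (mid j) : ℂ),
    (ℓ 0 ^ 2 - (∑ i : Fin (m + 1), signOf J i.succ * ℓ i.succ) ^ 2) /
      (2 * ∑ i : Fin (m + 2), signOf J i * ℓ i))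

/-! The equation `cobordismFun ℓ p = 0` can be solved locally in two ways, and each point of the
cobordism admits at least one of them.

Let S = ℓ_2 z_2 + ⋯ + ℓ_{n-1} z_{n-1} + ℓ_n + t. If some z_k is not parallel to S, the remaining
sides and t determine z_k as one of the two transversal intersection points of circles. The other
angles and ±t (up to a constant) are then coordinates (`exists_isLocalParamAt_slice`): the height is
regular there, and at the two end levels the chart becomes a half-space chart. If every z_k is
parallel to S, then S is real and nonzero, so every z_k is ±1; genericity rules out one of the two
possible values of S, and what remains is exactly the list of configurations q_J
(`exists_eq_criticalConfig`). The smallness of ε keeps these strictly between the end levels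
(`IsSmallEnough.two_mul_lt`).

At q_J the second method applies. The equation is affine in t with coefficient 2(Σ_{j≥2} u_j ℓ_j +
ℓ_1) ≠ 0, so the cobordism is a graph over the torus (`isLocalParamAt_graphParam`). In the angles,
with a_j = u_j ℓ_j, the Hessian of the height is a positive multiple of r Σ a_j v_j² - (Σ a_j v_j)²,
where r = ℓ_1 - t (`hessianAt_arcHeight_zero`). Since Σ a_j < r, the rank one term does not change
the signature (`sigNeg_diagonal_sub_sq`), and the index is the number of negative a_j, that is |J|.

Criticality and boundary membership are defined through some chart;
`IsLocalParamAt.fderiv_comp_eq_zero` and `IsLocalParamAt.notMem_manifoldBoundary` transfer them to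
the charts above. -/

/-! ### Change of local parametrization; invariance of critical points and of the boundary. -/

open Filter Topology in
/-- The transition map between two local parametrizations at the same point. -/
theorem IsLocalParamAt.exists_transition {E : Type*} [NormedAddCommGroup E] [NormedSpace ℝ E]
    {d : ℕ} {X : Set E} {p : E} {H₁ O₁ H₂ O₂ : Set (Fin d → ℝ)} {φ₁ φ₂ : (Fin d → ℝ) → E}
    {x₁ x₂ : Fin d → ℝ} (h₁ : IsLocalParamAt X p H₁ O₁ φ₁ x₁)
    (h₂ : IsLocalParamAt X p H₂ O₂ φ₂ x₂) :
    ∃ τ : (Fin d → ℝ) → (Fin d → ℝ), DifferentiableAt ℝ τ x₂ ∧ τ x₂ = x₁ ∧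
      ∀ᶠ y in 𝓝[H₂] x₂, τ y ∈ O₁ ∩ H₁ ∧ φ₁ (τ y) = φ₂ y := by
  obtain ⟨V₁, ψ₁, hV₁, him₁, hψ₁, hinv₁⟩ := h₁.exists_inverse
  obtain ⟨V₂, ψ₂, hV₂, him₂, hψ₂, hinv₂⟩ := h₂.exists_inverse
  have hpV : p ∈ V₁ := by
    have : φ₁ x₁ ∈ φ₁ '' (O₁ ∩ H₁) := ⟨x₁, h₁.mem, rfl⟩
    rw [him₁, h₁.map_eq] at this
    exact this.2
  have hO₂ : O₂ ∈ 𝓝 x₂ := h₂.isOpen.mem_nhds h₂.mem.1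
  have hφ₂ : DifferentiableAt ℝ φ₂ x₂ :=
    (h₂.contDiffOn.contDiffAt hO₂).differentiableAt (by simp)
  have hψ : DifferentiableAt ℝ ψ₁ (φ₂ x₂) := by
    rw [h₂.map_eq]
    exact (hψ₁.contDiffAt (hV₁.mem_nhds hpV)).differentiableAt (by simp)
  refine ⟨ψ₁ ∘ φ₂, hψ.comp x₂ hφ₂, ?_, ?_⟩
  · simp only [Function.comp_apply, h₂.map_eq]
    rw [← h₁.map_eq, hinv₁ _ h₁.mem]
  · have hpre : φ₂ ⁻¹' V₁ ∈ 𝓝 x₂ :=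
      hφ₂.continuousAt.preimage_mem_nhds (by rw [h₂.map_eq]; exact hV₁.mem_nhds hpV)
    filter_upwards [mem_nhdsWithin_of_mem_nhds hO₂, mem_nhdsWithin_of_mem_nhds hpre,
      self_mem_nhdsWithin] with y hyO hyV hyH
    have hX : φ₂ y ∈ X ∩ V₂ := him₂ ▸ ⟨y, ⟨hyO, hyH⟩, rfl⟩
    have : φ₂ y ∈ φ₁ '' (O₁ ∩ H₁) := him₁ ▸ ⟨hX.1, hyV⟩
    obtain ⟨y', hy', he⟩ := this
    simp only [Function.comp_apply]
    rw [← he, hinv₁ _ hy']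
    exact ⟨hy', rfl⟩

theorem IsLocalParamAt.mem_set {E : Type*} [NormedAddCommGroup E] [NormedSpace ℝ E]
    {d : ℕ} {X : Set E} {p : E} {H O : Set (Fin d → ℝ)} {φ : (Fin d → ℝ) → E}
    {x : Fin d → ℝ} (h : IsLocalParamAt X p H O φ x) : p ∈ X := by
  obtain ⟨V, ψ, -, him, -, -⟩ := h.exists_inverse
  have : φ x ∈ φ '' (O ∩ H) := ⟨x, h.mem, rfl⟩
  rw [him, h.map_eq] at this
  exact this.1

/-- Two charts can be compared only on the model domain, so at a boundary point the derivative has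
to be determined by one-sided information. -/
theorem IsModelDomain.uniqueDiffOn {d : ℕ} {H : Set (Fin d → ℝ)} (h : IsModelDomain H) :
    UniqueDiffOn ℝ H := by
  rcases h with rfl | ⟨i, rfl⟩
  · exact uniqueDiffOn_univ
  · refine uniqueDiffOn_convex ?_ ⟨fun _ => 1, ?_⟩
    · exact convex_halfSpace_ge (LinearMap.proj (R := ℝ) (φ := fun _ : Fin d => ℝ) i).isLinear 0
    · refine mem_interior.2 ⟨{x | 0 < x i}, fun x (hx : 0 < x i) => hx.le, ?_, ?_⟩
      · exact isOpen_lt continuous_const (continuous_apply i)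
      · simp

/-- Being a critical point does not depend on the local parametrization. -/
theorem IsLocalParamAt.fderiv_comp_eq_zero {E : Type*} [NormedAddCommGroup E] [NormedSpace ℝ E]
    {d : ℕ} {X : Set E} {p : E} {H O : Set (Fin d → ℝ)} {φ : (Fin d → ℝ) → E}
    {x : Fin d → ℝ} (h : IsLocalParamAt X p H O φ x) {g : E → ℝ} (hg : DifferentiableAt ℝ g p)
    (hc : IsCriticalPt d X g p) : fderiv ℝ (g ∘ φ) x = 0 := by
  obtain ⟨H₁, O₁, φ₁, x₁, h₁, hz⟩ := hc
  obtain ⟨τ, hτ, hτx, hev⟩ := h₁.exists_transition h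
  have hφ : DifferentiableAt ℝ φ x :=
    (h.contDiffOn.contDiffAt (h.isOpen.mem_nhds h.mem.1)).differentiableAt (by simp)
  have hφ₁ : DifferentiableAt ℝ φ₁ x₁ :=
    (h₁.contDiffOn.contDiffAt (h₁.isOpen.mem_nhds h₁.mem.1)).differentiableAt (by simp)
  have hgφ : DifferentiableAt ℝ (g ∘ φ) x := by
    refine DifferentiableAt.comp x ?_ hφ
    rwa [h.map_eq]
  have hgφ₁ : HasFDerivAt (g ∘ φ₁) (0 : (Fin d → ℝ) →L[ℝ] ℝ) (τ x) := by
    rw [hτx, ← hz]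
    refine (DifferentiableAt.comp x₁ ?_ hφ₁).hasFDerivAt
    rwa [h₁.map_eq]
  have hcomp : HasFDerivWithinAt ((g ∘ φ₁) ∘ τ) (0 : (Fin d → ℝ) →L[ℝ] ℝ) H x := by
    simpa using (hgφ₁.comp x hτ.hasFDerivAt).hasFDerivWithinAt (s := H)
  have hw : HasFDerivWithinAt (g ∘ φ) (0 : (Fin d → ℝ) →L[ℝ] ℝ) H x := by
    refine hcomp.congr_of_eventuallyEq ?_ ?_
    · filter_upwards [hev] with y hy
      simp [hy.2]
    · simp [hτx, h₁.map_eq, h.map_eq]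
  exact (h.model.uniqueDiffOn x h.mem.2).eq hgφ.hasFDerivAt.hasFDerivWithinAt hw

open Filter Topology in
/-- Invariance of the boundary. -/
theorem IsLocalParamAt.notMem_manifoldBoundary {E : Type*} [NormedAddCommGroup E]
    [NormedSpace ℝ E] {d : ℕ} {X : Set E} {p : E} {O : Set (Fin d → ℝ)}
    {φ : (Fin d → ℝ) → E} {x : Fin d → ℝ} (h : IsLocalParamAt X p Set.univ O φ x) :
    p ∉ manifoldBoundary d X := by
  rintro ⟨i, O₁, φ₁, x₁, h₁, hx₁⟩
  obtain ⟨τ, hτ, hτx, hev⟩ := h₁.exists_transition h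
  obtain ⟨σ, hσ, hσx, hev'⟩ := h.exists_transition h₁
  obtain ⟨V, ψ, -, -, -, hinv⟩ := h.exists_inverse
  rw [nhdsWithin_univ] at hev
  -- An open neighbourhood of `x` is mapped into the half-space with `x` going to its face, so the
  -- `i`-th row of the derivative of `τ` vanishes. This contradicts the invertibility of that
  -- derivative, obtained below from `σ ∘ τ = id` near `x`.
  have hmin : IsLocalMin (fun y => τ y i) x := by
    filter_upwards [hev] with y hy
    rw [hτx, hx₁]
    exact hy.1.2
  have hτi : HasFDerivAt (fun y => τ y i)
      ((ContinuousLinearMap.proj (R := ℝ) (φ := fun _ : Fin d => ℝ) i).comp (fderiv ℝ τ x)) x :=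
    (ContinuousLinearMap.proj (R := ℝ) (φ := fun _ : Fin d => ℝ) i).hasFDerivAt.comp x
      hτ.hasFDerivAt
  have hzero := hmin.hasFDerivAt_eq_zero hτi
  have htend : Tendsto τ (𝓝 x) (𝓝[{y | 0 ≤ y i}] x₁) := by
    refine tendsto_nhdsWithin_iff.2 ⟨?_, ?_⟩
    · have := hτ.continuousAt.tendsto
      rwa [hτx] at this
    · filter_upwards [hev] with y hy using hy.1.2
  have hid : (σ ∘ τ) =ᶠ[𝓝 x] id := by
    filter_upwards [hev, htend.eventually hev', h.isOpen.mem_nhds h.mem.1] with y hy hy' hyO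
    have h1 := hinv _ hy'.1
    have h2 := hinv y ⟨hyO, trivial⟩
    rw [hy'.2, hy.2, h2] at h1
    exact h1.symm
  have hσ' : DifferentiableAt ℝ σ (τ x) := by rwa [hτx]
  have hcomp : (fderiv ℝ σ (τ x)).comp (fderiv ℝ τ x) = ContinuousLinearMap.id ℝ _ :=
    (hσ'.hasFDerivAt.comp x hτ.hasFDerivAt).unique ((hasFDerivAt_id x).congr_of_eventuallyEq hid)
  have hinj : Function.Injective (fderiv ℝ τ x : (Fin d → ℝ) →ₗ[ℝ] (Fin d → ℝ)) := by
    refine Function.LeftInverse.injective (g := fderiv ℝ σ (τ x)) fun v => ?_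
    exact DFunLike.congr_fun hcomp v
  obtain ⟨v, hv⟩ := (LinearMap.injective_iff_surjective.1 hinj) (Pi.single i 1)
  have h1 := DFunLike.congr_fun hzero v
  have h2 := congrFun hv i
  simp only [ContinuousLinearMap.comp_apply, ContinuousLinearMap.proj_apply,
    zero_apply] at h1
  simp only [ContinuousLinearMap.coe_coe, h1, Pi.single_eq_same] at h2
  exact zero_ne_one h2

/-! ### Signature of the Hessian form. -/

/-- The index of a rank one perturbation of a diagonal quadratic form. -/
theorem sigNeg_diagonal_sub_sq {m : ℕ} (a : Fin m → ℝ) {r c : ℝ} (hr : 0 < r) (hc : 0 < c)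
    (hsum : ∑ j, a j < r) (Q : QuadraticForm ℝ (Fin m → ℝ))
    (hQ : ∀ v, Q v = c * (r * ∑ j, a j * (v j * v j) - (∑ j, a j * v j) ^ 2)) :
    sigNeg Q = {j | a j < 0}.ncard := by
  set A := ∑ j, a j with hA
  set s := √(r * (r - A)) with hs
  have hs2 : s ^ 2 = r * (r - A) := Real.sq_sqrt (mul_nonneg hr.le (sub_pos.2 hsum).le)
  have hs0 : 0 ≤ s := Real.sqrt_nonneg _
  have hrs : r + s ≠ 0 := by positivity
  -- The substitution v_j ↦ v_j + k Σ a_i v_i turns r Σ a_j v_j² into itself minus (Σ a_i v_i)²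
  -- exactly when rAk² + 2rk + 1 = 0. This is the root written so that it also makes sense for A =
  -- 0; A < r makes it real and the substitution invertible.
  let k : ℝ := -1 / (r + s)
  have hk : r * A * k ^ 2 + 2 * r * k + 1 = 0 := by
    simp only [k]
    field_simp
    linear_combination hs2
  have hk1 : 1 + k * A ≠ 0 := by
    have : 1 + k * A = (r + s - A) / (r + s) := by simp only [k]; field_simp; ring
    rw [this]
    exact div_ne_zero (by linarith) hrs
  let L : (Fin m → ℝ) →ₗ[ℝ] (Fin m → ℝ) :=
    { toFun := fun v j => v j + k * ∑ i, a i * v i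
      map_add' := fun v w => by
        ext j
        simp only [Pi.add_apply, mul_add, Finset.sum_add_distrib]
        ring
      map_smul' := fun b v => by
        ext j
        simp only [Pi.smul_apply, smul_eq_mul, RingHom.id_apply, mul_add, Finset.mul_sum]
        congr 1
        exact Finset.sum_congr rfl fun i _ => by ring }
  have hLσ : ∀ v, ∑ j, a j * L v j = (1 + k * A) * ∑ i, a i * v i := fun v => by
    simp only [L, LinearMap.coe_mk, AddHom.coe_mk, mul_add, Finset.sum_add_distrib,
      ← Finset.sum_mul, ← hA]
    ring
  have hinj : Function.Injective L := by
    rw [injective_iff_map_eq_zero]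
    intro v hv
    have h0 := hLσ v
    rw [hv] at h0
    simp only [Pi.zero_apply, mul_zero, Finset.sum_const_zero] at h0
    have h1 : ∑ i, a i * v i = 0 := (mul_eq_zero.1 h0.symm).resolve_left hk1
    ext j
    have h2 := congrFun hv j
    simpa [L, h1] using h2
  have hequiv : QuadraticMap.Equivalent Q
      (QuadraticMap.weightedSumSquares ℝ fun j => c * r * a j) := by
    refine ⟨⟨LinearEquiv.ofInjectiveEndo L hinj, fun v => ?_⟩⟩
    rw [QuadraticMap.weightedSumSquares_apply, hQ]
    have hexp : ∀ j, (c * r * a j) • ((LinearEquiv.ofInjectiveEndo L hinj).toFun v j *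
        (LinearEquiv.ofInjectiveEndo L hinj).toFun v j) =
        c * r * (a j * (v j * v j)) + c * r * (2 * k * ∑ i, a i * v i) * (a j * v j) +
          c * r * (k * ∑ i, a i * v i) ^ 2 * a j := fun j => by
      change (c * r * a j) • (L v j * L v j) = _
      simp only [L, LinearMap.coe_mk, AddHom.coe_mk, smul_eq_mul]
      ring
    rw [Finset.sum_congr rfl fun j _ => hexp j]
    simp only [Finset.sum_add_distrib, ← Finset.mul_sum, ← hA]
    linear_combination c * (∑ i, a i * v i) ^ 2 * hk
  rw [QuadraticForm.sigNeg_of_equiv_weightedSumSquares hequiv]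
  congr 1
  ext j
  simp only [Set.mem_ofPred_eq]
  constructor
  · intro h
    by_contra! h'
    exact absurd h (not_lt.2 (by positivity))
  · intro h
    exact mul_neg_of_pos_of_neg (mul_pos hc hr) h

/-! ### Short and long subsets -/

theorem isShort_iff_sum_sign {k : ℕ} (ℓ : Fin k → ℝ) (J : Finset (Fin k)) :
    IsShort ℓ J ↔ 0 < ∑ j, (if j ∈ J then -1 else 1) * ℓ j := by
  have h1 : ∑ j, (if j ∈ J then -1 else 1) * ℓ j = ∑ j ∈ Jᶜ, ℓ j - ∑ j ∈ J, ℓ j := by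
    rw [← Finset.sum_compl_add_sum J, Finset.sum_congr rfl (g := ℓ),
      Finset.sum_congr (s₁ := J) rfl (g := fun j => -ℓ j)]
    · simp [sub_eq_add_neg]
    · intro j hj; simp [hj]
    · intro j hj; simp [Finset.mem_compl.1 hj]
  rw [h1, sub_pos, IsShort]

theorem isLong_iff_sum_sign {k : ℕ} (ℓ : Fin k → ℝ) (J : Finset (Fin k)) :
    IsLong ℓ J ↔ ∑ j, (if j ∈ J then -1 else 1) * ℓ j < 0 := by
  rw [IsLong, isShort_iff_sum_sign, ← neg_pos, ← Finset.sum_neg_distrib]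
  refine iff_of_eq (congrArg _ (Finset.sum_congr rfl fun j _ => ?_))
  by_cases h : j ∈ J <;> simp [h]

theorem IsGenericLength.sum_sign_ne_zero {k : ℕ} {ℓ : Fin k → ℝ} (h : IsGenericLength ℓ)
    (J : Finset (Fin k)) : ∑ j, (if j ∈ J then -1 else 1) * ℓ j ≠ 0 := by
  intro h0
  have h1 := mt (isShort_iff_sum_sign ℓ J).1 h0.not_gt
  have h2 := mt (isLong_iff_sum_sign ℓ J).1 h0.not_lt
  rw [IsLong, IsShort, compl_compl] at h2
  exact h J (le_antisymm (not_lt.1 h2) (not_lt.1 h1))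

theorem mid_ne_zero {m : ℕ} (j : Fin m) : mid j ≠ 0 := by
  simp [mid, Fin.ext_iff]

theorem mid_ne_last {m : ℕ} (j : Fin m) : mid j ≠ Fin.last (m + 1) :=
  Fin.castSucc_ne_last _

theorem mid_injective {m : ℕ} : Function.Injective (mid (m := m)) :=
  (Fin.castSucc_injective _).comp (Fin.succ_injective _)

theorem succ_castSucc_eq_mid {m : ℕ} (j : Fin m) : (Fin.castSucc j).succ = mid j := rfl

theorem sum_fin_eq_sum_mid {m : ℕ} (F : Fin (m + 2) → ℝ) :
    ∑ i, F i = F 0 + (∑ j : Fin m, F (mid j) + F (Fin.last (m + 1))) := by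
  rw [Fin.sum_univ_succ, Fin.sum_univ_castSucc]
  rfl

theorem sum_succ_eq_sum_mid {m : ℕ} (F : Fin (m + 2) → ℝ) :
    ∑ i : Fin (m + 1), F i.succ = ∑ j : Fin m, F (mid j) + F (Fin.last (m + 1)) := by
  rw [Fin.sum_univ_castSucc]
  rfl

theorem mid_mem_image_mid {m : ℕ} (J : Finset (Fin m)) (j : Fin m) :
    mid j ∈ J.image mid ↔ j ∈ J := mid_injective.mem_finset_image

theorem zero_notMem_image_mid {m : ℕ} (J : Finset (Fin m)) :
    (0 : Fin (m + 2)) ∉ J.image mid := by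
  simp [mid_ne_zero]

theorem last_notMem_image_mid {m : ℕ} (J : Finset (Fin m)) :
    Fin.last (m + 1) ∉ J.image mid := by
  simp [mid_ne_last]

theorem last_ne_zero_fin (m : ℕ) : Fin.last (m + 1) ≠ 0 := by
  simp [Fin.ext_iff]

theorem shiftLength_zero {m : ℕ} (ℓ : Fin (m + 2) → ℝ) (t : ℝ) :
    shiftLength ℓ t 0 = ℓ 0 - t := by simp [shiftLength]

theorem shiftLength_mid {m : ℕ} (ℓ : Fin (m + 2) → ℝ) (t : ℝ) (j : Fin m) :
    shiftLength ℓ t (mid j) = ℓ (mid j) := by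
  simp [shiftLength, mid_ne_zero, mid_ne_last]

theorem shiftLength_last {m : ℕ} (ℓ : Fin (m + 2) → ℝ) (t : ℝ) :
    shiftLength ℓ t (Fin.last (m + 1)) = ℓ (Fin.last (m + 1)) + t := by
  simp [shiftLength]

/-- The signed sum `∑_{j=2}^n u_j ℓ_j` of the sides `2, …, n`. -/
noncomputable def tailSum {m : ℕ} (ℓ : Fin (m + 2) → ℝ) (J : Finset (Fin m)) : ℝ :=
  ∑ j : Fin m, (if j ∈ J then -1 else 1) * ℓ (mid j) + ℓ (Fin.last (m + 1))

theorem isShort_image_mid {m : ℕ} (ℓ : Fin (m + 2) → ℝ) (J : Finset (Fin m)) :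
    IsShort ℓ (J.image mid) ↔ 0 < ℓ 0 + tailSum ℓ J := by
  rw [isShort_iff_sum_sign, sum_fin_eq_sum_mid, tailSum]
  simp only [mid_mem_image_mid, zero_notMem_image_mid, last_notMem_image_mid, if_false, one_mul]

theorem sum_sign_insert_zero {m : ℕ} (ℓ : Fin (m + 2) → ℝ) (J : Finset (Fin m)) :
    ∑ j, (if j ∈ insert 0 (J.image mid) then -1 else 1) * ℓ j = -ℓ 0 + tailSum ℓ J := by
  rw [sum_fin_eq_sum_mid, tailSum]
  simp only [Finset.mem_insert, mid_mem_image_mid, mid_ne_zero, last_ne_zero_fin,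
    last_notMem_image_mid, if_false, one_mul, true_or, if_true, false_or, neg_mul]

theorem mem_criticalSets_iff {m : ℕ} (ℓ : Fin (m + 2) → ℝ) (J : Finset (Fin m)) :
    J ∈ criticalSets ℓ ↔ 0 < ℓ 0 + tailSum ℓ J ∧ tailSum ℓ J < ℓ 0 := by
  rw [criticalSets, Set.mem_ofPred_eq, isShort_image_mid, isLong_iff_sum_sign,
    sum_sign_insert_zero, neg_add_lt_iff_lt_add, add_zero]

theorem IsGenericLength.tailSum_ne {m : ℕ} {ℓ : Fin (m + 2) → ℝ} (h : IsGenericLength ℓ)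
    (J : Finset (Fin m)) : tailSum ℓ J ≠ ℓ 0 := fun h' =>
  h.sum_sign_ne_zero _ ((sum_sign_insert_zero ℓ J).trans (by linarith))

theorem IsGenericLength.add_tailSum_ne_zero {m : ℕ} {ℓ : Fin (m + 2) → ℝ}
    (h : IsGenericLength ℓ) (J : Finset (Fin m)) : ℓ 0 + tailSum ℓ J ≠ 0 := by
  have := h.sum_sign_ne_zero (J.image mid)
  rw [sum_fin_eq_sum_mid] at this
  rw [tailSum]
  simpa only [mid_mem_image_mid, zero_notMem_image_mid, last_notMem_image_mid, if_false,
    one_mul] using this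

theorem sum_sign_mergeLength {m : ℕ} (ℓ : Fin (m + 2) → ℝ) (J : Finset (Fin (m + 2))) :
    ∑ i, (if i ∈ (Finset.univ.filter fun i : Fin (m + 1) => i.succ ∈ J) then -1 else 1) *
      mergeLength ℓ i = ∑ j : Fin m, (if mid j ∈ J then -1 else 1) * ℓ (mid j) +
        (if Fin.last (m + 1) ∈ J then -1 else 1) * (ℓ (Fin.last (m + 1)) + ℓ 0) := by
  rw [Fin.sum_univ_castSucc]
  simp only [Finset.mem_filter, Finset.mem_univ, true_and, succ_castSucc_eq_mid, Fin.succ_last,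
    mergeLength, Fin.castSucc_ne_last, if_false, if_true]

theorem sum_sign_shiftLength {m : ℕ} (ℓ : Fin (m + 2) → ℝ) (t : ℝ)
    (J : Finset (Fin (m + 2))) :
    ∑ i, (if i ∈ J then -1 else 1) * shiftLength ℓ t i =
      (if (0 : Fin (m + 2)) ∈ J then -1 else 1) * (ℓ 0 - t) +
        (∑ j : Fin m, (if mid j ∈ J then -1 else 1) * ℓ (mid j) +
          (if Fin.last (m + 1) ∈ J then -1 else 1) * (ℓ (Fin.last (m + 1)) + t)) := by
  rw [sum_fin_eq_sum_mid]
  simp only [shiftLength_zero, shiftLength_mid, shiftLength_last]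

/-- The merged vector does not see side 1, so {1} ∪ J may be tested instead of J. Its signed sum is
ℓ_1 + `tailSum ℓ J` for the merged vector and 2ε less for the shifted one; both must be positive
together. -/
theorem IsSmallEnough.two_mul_lt {m : ℕ} {ℓ : Fin (m + 2) → ℝ} {ε : ℝ}
    (h : IsSmallEnough ℓ ε) {J : Finset (Fin m)} (hJ : 0 < ℓ 0 + tailSum ℓ J) :
    2 * ε < ℓ 0 + tailSum ℓ J := by
  have h1 := h.2.2 (insert 0 (J.image mid))
  rw [isShort_iff_sum_sign, isShort_iff_sum_sign, sum_sign_mergeLength,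
    sum_sign_shiftLength] at h1
  simp only [Finset.mem_insert, mid_mem_image_mid, mid_ne_zero, last_ne_zero_fin,
    last_notMem_image_mid, if_false, one_mul, true_or, if_true, false_or, neg_mul] at h1
  rw [tailSum] at hJ ⊢
  simp only [neg_mul, ite_mul, one_mul] at h1 hJ ⊢
  have := h1.2 (by linarith)
  linarith

/-- A signed sum of the merged vector is a signed sum of ℓ in which sides 1 and n carry the same
sign, so genericity is applied to J with 1 inserted or erased accordingly. -/
theorem IsGenericLength.sum_sign_mergeLength_ne_zero {m : ℕ} {ℓ : Fin (m + 2) → ℝ}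
    (h : IsGenericLength ℓ) (J : Finset (Fin (m + 2))) :
    ∑ j : Fin m, (if mid j ∈ J then -1 else 1) * ℓ (mid j) +
      (if Fin.last (m + 1) ∈ J then -1 else 1) * (ℓ (Fin.last (m + 1)) + ℓ 0) ≠ 0 := by
  by_cases hl : Fin.last (m + 1) ∈ J
  · have := h.sum_sign_ne_zero (insert 0 J)
    rw [sum_fin_eq_sum_mid] at this
    simp only [Finset.mem_insert, true_or, if_true, mid_ne_zero, false_or, hl, or_true] at this ⊢
    intro h0
    exact this (by linarith)
  · have := h.sum_sign_ne_zero (J.erase 0)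
    rw [sum_fin_eq_sum_mid] at this
    simp only [Finset.mem_erase, ne_eq, mid_ne_zero, not_false_eq_true, true_and, hl, if_false,
      and_false, not_true_eq_false, false_and] at this ⊢
    intro h0
    exact this (by linarith)

open Filter Topology in
theorem IsGenericLength.exists_isSmallEnough {m : ℕ} {ℓ : Fin (m + 2) → ℝ}
    (h : IsGenericLength ℓ) (h0 : 0 < ℓ 0) :
    ∃ ε₀ > 0, ∀ ε, 0 < ε → ε < ε₀ → IsSmallEnough ℓ ε := by
  let N : Finset (Fin (m + 2)) → ℝ := fun J =>
    ∑ j : Fin m, (if mid j ∈ J then -1 else 1) * ℓ (mid j) +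
      (if Fin.last (m + 1) ∈ J then -1 else 1) * (ℓ (Fin.last (m + 1)) + ℓ 0)
  have hN : ∀ J, 0 < |N J| / 2 := fun J =>
    half_pos (abs_pos.2 (h.sum_sign_mergeLength_ne_zero J))
  have hev : ∀ᶠ ε in 𝓝[>] (0 : ℝ), ε < ℓ 0 ∧ ∀ J, ε < |N J| / 2 :=
    mem_nhdsWithin_of_mem_nhds ((eventually_lt_nhds h0).and
      (eventually_all.2 fun J => eventually_lt_nhds (hN J)))
  obtain ⟨ε₀, hε₀, hsub⟩ := (mem_nhdsGT_iff_exists_Ioo_subset).1 hev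
  refine ⟨ε₀, hε₀, fun ε hε hlt => ?_⟩
  obtain ⟨h1, h2⟩ := hsub ⟨hε, hlt⟩
  refine ⟨hε, h1, fun J => ?_⟩
  rw [isShort_iff_sum_sign, isShort_iff_sum_sign, sum_sign_mergeLength, sum_sign_shiftLength]
  have h3 := h2 J
  change _ ↔ 0 < N J
  -- Shifted and merged signed sums differ by ±ε from side 1 and ±ε from side n. Hence the threshold
  -- |N J| / 2, below which the sign of N J is not affected.
  have h4 : ∃ d : ℝ, |d| ≤ 2 * ε ∧ (if (0 : Fin (m + 2)) ∈ J then -1 else 1) *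
      (ℓ 0 - (ℓ 0 - ε)) + (∑ j : Fin m, (if mid j ∈ J then -1 else 1) * ℓ (mid j) +
        (if Fin.last (m + 1) ∈ J then -1 else 1) * (ℓ (Fin.last (m + 1)) + (ℓ 0 - ε))) =
      N J + d := by
    refine ⟨(if (0 : Fin (m + 2)) ∈ J then -1 else 1) * ε -
      (if Fin.last (m + 1) ∈ J then -1 else 1) * ε, ?_, by simp only [N]; ring⟩
    rw [abs_le]
    split_ifs <;> constructor <;> linarith
  obtain ⟨d, hd, he⟩ := h4
  rw [he]
  obtain ⟨hd1, hd2⟩ := abs_le.1 hd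
  rcases abs_cases (N J) with ⟨ha, hb⟩ | ⟨ha, hb⟩
  · constructor <;> intro <;> linarith
  · constructor <;> intro <;> linarith

/-! ### The signs of a collinear configuration -/

theorem signOf_mid {m : ℕ} (J : Finset (Fin m)) (j : Fin m) :
    signOf J (mid j) = if j ∈ J then -1 else 1 := by
  simp only [signOf, mid_mem_image_mid]

theorem sum_signOf_succ {m : ℕ} (ℓ : Fin (m + 2) → ℝ) (J : Finset (Fin m)) :
    ∑ i : Fin (m + 1), signOf J i.succ * ℓ i.succ = tailSum ℓ J := by
  rw [sum_succ_eq_sum_mid fun i => signOf J i * ℓ i, tailSum]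
  simp only [signOf, mid_mem_image_mid, last_notMem_image_mid, if_false, one_mul]

theorem sum_signOf {m : ℕ} (ℓ : Fin (m + 2) → ℝ) (J : Finset (Fin m)) :
    ∑ i, signOf J i * ℓ i = ℓ 0 + tailSum ℓ J := by
  rw [Fin.sum_univ_succ, sum_signOf_succ]
  simp only [signOf, zero_notMem_image_mid, if_false, one_mul]

/-- The numerator is a difference of squares and cancels against the denominator. -/
theorem criticalConfig_snd {m : ℕ} {ℓ : Fin (m + 2) → ℝ} {J : Finset (Fin m)}
    (h : ℓ 0 + tailSum ℓ J ≠ 0) : (criticalConfig ℓ J).2 = (ℓ 0 - tailSum ℓ J) / 2 := by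
  simp only [criticalConfig, sum_signOf, sum_signOf_succ]
  field_simp
  ring

theorem criticalConfig_injective {m : ℕ} (ℓ : Fin (m + 2) → ℝ) :
    Function.Injective (criticalConfig ℓ) := by
  intro J K h
  ext j
  have h1 := congrFun (congrArg Prod.fst h) j
  simp only [criticalConfig, signOf_mid] at h1
  by_cases hJ : j ∈ J <;> by_cases hK : j ∈ K <;> simp only [hJ, hK] at h1 ⊢ <;> norm_num at h1

/-! ### The cobordism -/

/-- The complex number `ℓ_2 z_2 + ⋯ + ℓ_{n-1} z_{n-1}`. -/
noncomputable def midSum {m : ℕ} (ℓ : Fin (m + 2) → ℝ) (z : Fin m → ℂ) : ℂ :=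
  ∑ j : Fin m, (ℓ (mid j) : ℂ) * z j

theorem contDiff_midSum {m : ℕ} (ℓ : Fin (m + 2) → ℝ) : ContDiff ℝ ∞ (midSum ℓ) :=
  ContDiff.sum fun j _ => contDiff_const.mul (contDiff_apply ℝ ℂ j)

theorem cobordismFun_eq_norm {m : ℕ} (ℓ : Fin (m + 2) → ℝ) (p : (Fin m → ℂ) × ℝ) :
    cobordismFun ℓ p =
      ‖midSum ℓ p.1 + ((ℓ (Fin.last (m + 1)) + p.2 : ℝ) : ℂ)‖ ^ 2 - (ℓ 0 - p.2) ^ 2 := by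
  rw [cobordismFun, midSum, add_assoc, Complex.ofReal_add]

/-- The function whose zero set is the cobordism is affine in the height. -/
theorem cobordismFun_eq {m : ℕ} (ℓ : Fin (m + 2) → ℝ) (p : (Fin m → ℂ) × ℝ) :
    cobordismFun ℓ p = ((midSum ℓ p.1).re + ℓ (Fin.last (m + 1))) ^ 2 + (midSum ℓ p.1).im ^ 2 -
      ℓ 0 ^ 2 + 2 * p.2 * ((midSum ℓ p.1).re + ℓ (Fin.last (m + 1)) + ℓ 0) := by
  rw [cobordismFun_eq_norm, Complex.sq_norm, Complex.normSq_apply]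
  simp only [Complex.add_re, Complex.add_im, Complex.ofReal_re, Complex.ofReal_im]
  ring

theorem continuous_cobordismFun {m : ℕ} (ℓ : Fin (m + 2) → ℝ) :
    Continuous (cobordismFun ℓ) := by
  have := (contDiff_midSum ℓ).continuous
  rw [funext (cobordismFun_eq ℓ)]
  fun_prop

theorem isCompact_cobordismW {m : ℕ} (ℓ : Fin (m + 2) → ℝ) (ε : ℝ) :
    IsCompact (cobordismW ℓ ε) := by
  have hK : IsCompact ((Set.univ.pi fun _ : Fin m => Metric.sphere (0 : ℂ) 1) ×ˢ
      Set.Icc (0 : ℝ) (ℓ 0 - ε)) :=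
    (isCompact_univ_pi fun _ => isCompact_sphere _ _).prod isCompact_Icc
  have h : cobordismW ℓ ε = ((Set.univ.pi fun _ : Fin m => Metric.sphere (0 : ℂ) 1) ×ˢ
      Set.Icc (0 : ℝ) (ℓ 0 - ε)) ∩ cobordismFun ℓ ⁻¹' {0} := by
    ext p
    simp [cobordismW, Set.mem_pi, and_assoc]
  rw [h]
  exact hK.inter_right (isClosed_singleton.preimage (continuous_cobordismFun ℓ))

theorem mem_polygonSpace_shiftLength_iff {m : ℕ} (ℓ : Fin (m + 2) → ℝ) (t : ℝ)
    (z : Fin (m + 1) → ℂ) : z ∈ polygonSpace (shiftLength ℓ t) ↔ (∀ i, ‖z i‖ = 1) ∧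
      ((ℓ 0 - t : ℝ) : ℂ) * z 0 + (midSum ℓ (fun j => z j.succ) +
        ((ℓ (Fin.last (m + 1)) + t : ℝ) : ℂ)) = 0 := by
  have h : ∑ i : Fin (m + 1), (shiftLength ℓ t i.castSucc : ℂ) * z i +
      (shiftLength ℓ t (Fin.last (m + 1)) : ℂ) = ((ℓ 0 - t : ℝ) : ℂ) * z 0 +
      (midSum ℓ (fun j => z j.succ) + ((ℓ (Fin.last (m + 1)) + t : ℝ) : ℂ)) := by
    rw [Fin.sum_univ_succ, shiftLength_last, Fin.castSucc_zero, shiftLength_zero, midSum, add_assoc]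
    congr 2
    exact Finset.sum_congr rfl fun j _ => by rw [← mid, shiftLength_mid]
  rw [polygonSpace, Set.mem_ofPred_eq, h]

/-- The first side of the polygon, in terms of the others. -/
noncomputable def firstSide {m : ℕ} (ℓ : Fin (m + 2) → ℝ) (p : (Fin m → ℂ) × ℝ) (t : ℝ) : ℂ :=
  (((-(ℓ 0 - t)⁻¹ : ℝ)) : ℂ) * (midSum ℓ p.1 + ((ℓ (Fin.last (m + 1)) + t : ℝ) : ℂ))

theorem firstSide_eq {m : ℕ} {ℓ : Fin (m + 2) → ℝ} {t : ℝ} (ht : ℓ 0 - t ≠ 0)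
    {z : Fin (m + 1) → ℂ} (hz : z ∈ polygonSpace (shiftLength ℓ t)) (s : ℝ) :
    firstSide ℓ (fun j => z j.succ, s) t = z 0 := by
  have h := ((mem_polygonSpace_shiftLength_iff ℓ t z).1 hz).2
  have ht' : ((ℓ 0 - t : ℝ) : ℂ) ≠ 0 := by exact_mod_cast ht
  rw [firstSide, Complex.ofReal_neg, Complex.ofReal_inv]
  field_simp
  linear_combination -h

/-- As long as ℓ_1 - t ≠ 0, closing the polygon determines z_1, and the equation of the cobordism
says precisely that this z_1 has modulus 1. -/
theorem mem_polygonSlice_iff {m : ℕ} {ℓ : Fin (m + 2) → ℝ} {t : ℝ} (ht : ℓ 0 - t ≠ 0)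
    (p : (Fin m → ℂ) × ℝ) :
    p ∈ polygonSlice ℓ t ↔ (∀ j, ‖p.1 j‖ = 1) ∧ p.2 = t ∧ cobordismFun ℓ p = 0 := by
  constructor
  · rintro ⟨z, hz, rfl⟩
    have h := (mem_polygonSpace_shiftLength_iff ℓ t z).1 hz
    refine ⟨fun j => h.1 _, rfl, ?_⟩
    rw [cobordismFun_eq_norm]
    simp only
    rw [← neg_eq_iff_add_eq_zero.2 h.2, norm_neg, norm_mul, h.1, mul_one, Complex.norm_real,
      Real.norm_eq_abs, sq_abs, sub_self]
  · rintro ⟨hz, rfl, hf⟩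
    have ht' : ((ℓ 0 - p.2 : ℝ) : ℂ) ≠ 0 := by exact_mod_cast ht
    refine ⟨Fin.cons (firstSide ℓ p p.2) p.1, ?_, ?_⟩
    · rw [mem_polygonSpace_shiftLength_iff]
      constructor
      · refine Fin.cases ?_ fun j => ?_
        · rw [Fin.cons_zero, firstSide, norm_mul, Complex.norm_real, Real.norm_eq_abs, abs_neg,
            abs_inv]
          rw [cobordismFun_eq_norm, sub_eq_zero, sq_eq_sq_iff_abs_eq_abs, abs_norm] at hf
          rw [hf, inv_mul_cancel₀ (abs_ne_zero.2 ht)]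
        · simpa using hz j
      · simp only [Fin.cons_zero, Fin.cons_succ]
        rw [firstSide, Complex.ofReal_neg, Complex.ofReal_inv]
        field_simp
        ring
    · simp only [Fin.cons_succ]

theorem areDiffeomorphic_polygonSlice {m : ℕ} {ℓ : Fin (m + 2) → ℝ} {t : ℝ}
    (ht : ℓ 0 - t ≠ 0) :
    AreDiffeomorphic (polygonSpace (shiftLength ℓ t)) (polygonSlice ℓ t) := by
  refine ⟨fun z => (fun j => z j.succ, t), fun p => Fin.cons (firstSide ℓ p t) p.1, Set.univ,
    Set.univ, isOpen_univ, Set.subset_univ _, ?_, isOpen_univ, Set.subset_univ _, ?_,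
    fun z hz => ⟨z, hz, rfl⟩, ?_, ?_, ?_⟩
  · refine ContDiff.contDiffOn (ContDiff.prodMk ?_ contDiff_const)
    exact contDiff_pi.2 fun j => contDiff_apply ℝ ℂ j.succ
  · refine ContDiff.contDiffOn (contDiff_pi.2 (Fin.cases ?_ fun j => ?_))
    · simp only [Fin.cons_zero]
      exact contDiff_const.mul (((contDiff_midSum ℓ).comp contDiff_fst).add contDiff_const)
    · simp only [Fin.cons_succ]
      exact (contDiff_apply ℝ ℂ j).comp contDiff_fst
  · rintro _ ⟨z, hz, rfl⟩
    convert hz using 1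
    ext1 i
    refine Fin.cases ?_ (fun j => ?_) i
    · simp only [Fin.cons_zero, firstSide_eq ht hz]
    · simp only [Fin.cons_succ]
  · intro z hz
    ext1 i
    refine Fin.cases ?_ (fun j => ?_) i
    · simp only [Fin.cons_zero, firstSide_eq ht hz]
    · simp only [Fin.cons_succ]
  · rintro _ ⟨z, hz, rfl⟩
    simp only [Fin.cons_succ]

theorem inter_preimage_snd_eq_polygonSlice {m : ℕ} {ℓ : Fin (m + 2) → ℝ} {ε t : ℝ}
    (hε : 0 < ε) (ht : t ∈ Set.Icc 0 (ℓ 0 - ε)) :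
    cobordismW ℓ ε ∩ Prod.snd ⁻¹' {t} = polygonSlice ℓ t := by
  ext p
  have ht' : ℓ 0 - t ≠ 0 := by
    have := ht.2
    exact ne_of_gt (by linarith)
  rw [mem_polygonSlice_iff ht']
  constructor
  · rintro ⟨⟨h1, -, h2⟩, h3⟩
    exact ⟨h1, h3, h2⟩
  · rintro ⟨h1, h3, h2⟩
    exact ⟨⟨h1, h3 ▸ ht, h2⟩, h3⟩

/-! ### Collinear configurations -/

theorem midSum_sign {m : ℕ} (ℓ : Fin (m + 2) → ℝ) (J : Finset (Fin m)) :
    midSum ℓ (fun j => ((if j ∈ J then -1 else 1 : ℝ) : ℂ)) =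
      ((tailSum ℓ J - ℓ (Fin.last (m + 1)) : ℝ) : ℂ) := by
  rw [midSum, tailSum, add_sub_cancel_right, Complex.ofReal_sum]
  exact Finset.sum_congr rfl fun j _ => by rw [Complex.ofReal_mul, mul_comm]

theorem criticalConfig_eq {m : ℕ} {ℓ : Fin (m + 2) → ℝ} {J : Finset (Fin m)}
    (h : ℓ 0 + tailSum ℓ J ≠ 0) : criticalConfig ℓ J =
      (fun j => ((if j ∈ J then -1 else 1 : ℝ) : ℂ), (ℓ 0 - tailSum ℓ J) / 2) := by
  refine Prod.ext ?_ (criticalConfig_snd h)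
  ext j
  simp only [criticalConfig, signOf_mid]

/-- Positivity of the height comes from {1} ∪ J being long, the upper bound from J being short
together with the choice of ε. -/
theorem criticalConfig_snd_mem_Ioo {m : ℕ} {ℓ : Fin (m + 2) → ℝ} {ε : ℝ}
    (hε : IsSmallEnough ℓ ε) {J : Finset (Fin m)} (hJ : J ∈ criticalSets ℓ) :
    (criticalConfig ℓ J).2 ∈ Set.Ioo 0 (ℓ 0 - ε) := by
  obtain ⟨h1, h2⟩ := (mem_criticalSets_iff ℓ J).1 hJ
  rw [criticalConfig_snd h1.ne']
  have := hε.two_mul_lt h1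
  constructor <;> linarith

theorem criticalConfig_mem_cobordismW {m : ℕ} {ℓ : Fin (m + 2) → ℝ} {ε : ℝ}
    (hε : IsSmallEnough ℓ ε) {J : Finset (Fin m)} (hJ : J ∈ criticalSets ℓ) :
    criticalConfig ℓ J ∈ cobordismW ℓ ε := by
  have h1 := ((mem_criticalSets_iff ℓ J).1 hJ).1
  refine ⟨fun j => ?_, Set.Ioo_subset_Icc_self (criticalConfig_snd_mem_Ioo hε hJ), ?_⟩
  · rw [criticalConfig_eq h1.ne', Complex.norm_real]
    split_ifs <;> simp
  · rw [criticalConfig_eq h1.ne', cobordismFun_eq]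
    simp only [midSum_sign, Complex.ofReal_re, Complex.ofReal_im]
    ring

/-- The points of the cobordism at which the sides `2, …, n-1` are parallel to their sum are the
collinear configurations. -/
theorem exists_eq_criticalConfig {m : ℕ} {ℓ : Fin (m + 2) → ℝ} (hpos : ∀ i, 0 < ℓ i)
    (hgen : IsGenericLength ℓ) {ε : ℝ} (hε : 0 < ε) {p : (Fin m → ℂ) × ℝ}
    (hp : p ∈ cobordismW ℓ ε)
    (hcol : ∀ k, ((starRingEnd ℂ) (midSum ℓ p.1 + ((ℓ (Fin.last (m + 1)) + p.2 : ℝ) : ℂ)) *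
      p.1 k).im = 0) : ∃ J ∈ criticalSets ℓ, criticalConfig ℓ J = p := by
  obtain ⟨hz, ⟨ht0, htT⟩, hf⟩ := hp
  obtain ⟨z, t⟩ := p
  simp only at hz ht0 htT hcol
  set S := midSum ℓ z + ((ℓ (Fin.last (m + 1)) + t : ℝ) : ℂ) with hS
  -- Parallelism passes to the sum of the sides 2, …, n-1. This differs from S by the positive real
  -- ℓ_n + t, so S itself is real.
  have hA : ((starRingEnd ℂ) S * midSum ℓ z).im = 0 := by
    rw [midSum, Finset.mul_sum, Complex.im_sum]
    refine Finset.sum_eq_zero fun j _ => ?_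
    rw [mul_left_comm, Complex.im_ofReal_mul, hcol j, mul_zero]
  have hSim : S.im = 0 := by
    have h1 : midSum ℓ z = S - ((ℓ (Fin.last (m + 1)) + t : ℝ) : ℂ) := by rw [hS]; ring
    rw [h1] at hA
    simp only [Complex.mul_im, Complex.conj_re, Complex.conj_im, Complex.sub_re, Complex.sub_im,
      Complex.ofReal_re, Complex.ofReal_im] at hA
    have h2 : S.im * (ℓ (Fin.last (m + 1)) + t) = 0 := by linarith
    exact (mul_eq_zero.1 h2).resolve_right (by have := hpos (Fin.last (m + 1)); positivity)
  have hSre : S.re ^ 2 = (ℓ 0 - t) ^ 2 := by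
    rw [cobordismFun_eq_norm, sub_eq_zero] at hf
    simp only at hf
    rw [← hS, Complex.sq_norm, Complex.normSq_apply, hSim] at hf
    linarith
  have hSre0 : S.re ≠ 0 := by
    intro h
    rw [h] at hSre
    have : ℓ 0 - t = 0 := by simpa using hSre.symm
    linarith
  have hzim : ∀ j, (z j).im = 0 := fun j => by
    have := hcol j
    rw [Complex.mul_im, Complex.conj_re, Complex.conj_im, hSim] at this
    simpa [hSre0] using this
  have hzre : ∀ j, (z j).re = 1 ∨ (z j).re = -1 := fun j => by
    have := Complex.sq_norm (z j)
    rw [hz j, Complex.normSq_apply, hzim j] at this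
    exact sq_eq_one_iff.1 (by linarith)
  let J : Finset (Fin m) := Finset.univ.filter fun j => (z j).re = -1
  have hzJ : z = fun j => ((if j ∈ J then -1 else 1 : ℝ) : ℂ) := by
    ext1 j
    refine Complex.ext ?_ (by rw [hzim j, Complex.ofReal_im])
    rw [Complex.ofReal_re]
    simp only [J, Finset.mem_filter, Finset.mem_univ, true_and]
    split_ifs with h
    · exact h
    · exact (hzre j).resolve_right h
  have hSJ : S.re = tailSum ℓ J + t := by
    rw [hS, hzJ, midSum_sign, Complex.add_re, Complex.ofReal_re, Complex.ofReal_re]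
    ring
  have hsum := hgen.add_tailSum_ne_zero J
  -- The other root, S = -(ℓ_1 - t), would give a vanishing signed sum of all sides, independently
  -- of t.
  have ht : tailSum ℓ J = ℓ 0 - 2 * t := by
    rcases sq_eq_sq_iff_eq_or_eq_neg.1 hSre with h | h
    · linarith
    · exact absurd (by linarith) hsum
  have ht0' : t ≠ 0 := fun h => hgen.tailSum_ne J (by rw [ht, h]; ring)
  have hJ : J ∈ criticalSets ℓ := by
    rw [mem_criticalSets_iff, ht]
    have := lt_of_le_of_ne ht0 ht0'.symm
    constructor <;> linarith
  refine ⟨J, hJ, ?_⟩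
  rw [criticalConfig_eq hsum, ← hzJ, ht]
  refine Prod.ext rfl ?_
  simp only
  ring

/-! ### The Hessian of the height function at a collinear configuration -/

/-- The height `t` at which `∑ a_j exp (i θ_j) + b + t` has norm `|c - t|`. -/
noncomputable def arcHeight {m : ℕ} (a : Fin m → ℝ) (b c : ℝ) (θ : Fin m → ℝ) : ℝ :=
  (c ^ 2 - (∑ j, a j * Real.cos (θ j) + b) ^ 2 - (∑ j, a j * Real.sin (θ j)) ^ 2) /
    (2 * (∑ j, a j * Real.cos (θ j) + b + c))

/-- The linear form `v ↦ ∑ c_j v_j`. -/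
noncomputable def sumForm {m : ℕ} (c : Fin m → ℝ) : (Fin m → ℝ) →L[ℝ] ℝ :=
  ∑ j, c j • ContinuousLinearMap.proj (R := ℝ) (φ := fun _ : Fin m => ℝ) j

theorem sumForm_apply {m : ℕ} (c v : Fin m → ℝ) : sumForm c v = ∑ j, c j * v j := by
  simp [sumForm]

theorem hasFDerivAt_sum_cos {m : ℕ} (a θ : Fin m → ℝ) :
    HasFDerivAt (fun θ : Fin m → ℝ => ∑ j, a j * Real.cos (θ j))
      (sumForm fun j => -(a j * Real.sin (θ j))) θ := by
  refine HasFDerivAt.fun_sum fun j _ => ?_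
  have h := ((hasFDerivAt_apply (𝕜 := ℝ) j θ).cos).const_mul (a j)
  refine h.congr_fderiv ?_
  rw [smul_smul, mul_neg]

theorem hasFDerivAt_sum_sin {m : ℕ} (a θ : Fin m → ℝ) :
    HasFDerivAt (fun θ : Fin m → ℝ => ∑ j, a j * Real.sin (θ j))
      (sumForm fun j => a j * Real.cos (θ j)) θ := by
  refine HasFDerivAt.fun_sum fun j _ => ?_
  have h := ((hasFDerivAt_apply (𝕜 := ℝ) j θ).sin).const_mul (a j)
  refine h.congr_fderiv ?_
  rw [smul_smul]

/-- The numerator of the differential of `arcHeight`. -/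
noncomputable def arcHeightForm {m : ℕ} (a : Fin m → ℝ) (b c : ℝ) (θ : Fin m → ℝ) :
    (Fin m → ℝ) →L[ℝ] ℝ :=
  (-(∑ j, a j * Real.cos (θ j) + b + arcHeight a b c θ)) •
      sumForm (fun j => -(a j * Real.sin (θ j))) -
    (∑ j, a j * Real.sin (θ j)) • sumForm (fun j => a j * Real.cos (θ j))

/-- This is implicit differentiation of (C + b + t)² + S² = (c - t)², with C and S the cosine and
sine sums. Keeping `arcHeight` itself inside the form avoids differentiating the quotient a second
time. -/
theorem hasFDerivAt_arcHeight {m : ℕ} (a : Fin m → ℝ) {b c : ℝ} {θ : Fin m → ℝ}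
    (h : ∑ j, a j * Real.cos (θ j) + b + c ≠ 0) :
    HasFDerivAt (arcHeight a b c)
      ((∑ j, a j * Real.cos (θ j) + b + c)⁻¹ • arcHeightForm a b c θ) θ := by
  have hC := hasFDerivAt_sum_cos a θ
  have hS := hasFDerivAt_sum_sin a θ
  have hnum := ((hC.add_const b).pow 2).const_sub (c ^ 2) |>.sub (hS.pow 2)
  have hden := ((hC.add_const b).add_const c).const_mul 2
  have hinv := (hasDerivAt_inv (mul_ne_zero two_ne_zero h)).comp_hasFDerivAt θ hden
  have hmul := hnum.mul hinv
  refine (hmul.congr_fderiv ?_).congr_of_eventuallyEq (Filter.Eventually.of_forall fun x => ?_)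
  · ext v
    simp only [arcHeightForm, arcHeight, smul_apply, add_apply, sub_apply, neg_apply,
      smul_eq_mul, Pi.sub_apply, Function.comp_apply]
    field_simp
    ring
  · simp only [arcHeight, Pi.mul_apply, Pi.sub_apply, Function.comp_apply,
      div_eq_mul_inv]

theorem fderiv_arcHeight_zero {m : ℕ} (a : Fin m → ℝ) {b c : ℝ} (h : ∑ j, a j + b + c ≠ 0) :
    fderiv ℝ (arcHeight a b c) 0 = 0 := by
  rw [(hasFDerivAt_arcHeight a (θ := 0) (by simpa using h)).fderiv]
  ext v
  simp [arcHeightForm, sumForm_apply]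

/-- At 0 the sine sum, dC and dt all vanish. Of the derivative of the first-order formula only two
terms survive: the second derivative of C, which is diagonal, and dS ⊗ dS. -/
theorem hessianAt_arcHeight_zero {m : ℕ} (a : Fin m → ℝ) {b c : ℝ}
    (h : ∑ j, a j + b + c ≠ 0) (v w : Fin m → ℝ) :
    hessianAt (arcHeight a b c) 0 v w = (∑ j, a j + b + c)⁻¹ *
      ((∑ j, a j + b + arcHeight a b c 0) * ∑ j, a j * (v j * w j) -
        (∑ j, a j * v j) * ∑ j, a j * w j) := by
  have hc0 : ∑ j, a j * Real.cos ((0 : Fin m → ℝ) j) + b + c ≠ 0 := by simpa using h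
  have hcont : Continuous fun θ : Fin m → ℝ => ∑ j, a j * Real.cos (θ j) + b + c := by fun_prop
  have hev : fderiv ℝ (arcHeight a b c) =ᶠ[nhds 0] fun θ =>
      (∑ j, a j * Real.cos (θ j) + b + c)⁻¹ • arcHeightForm a b c θ := by
    filter_upwards [hcont.continuousAt.eventually_ne hc0] with θ hθ
      using (hasFDerivAt_arcHeight a hθ).fderiv
  have hcos := ((hasFDerivAt_sum_cos a 0).add_const b).add_const c
  have hτ := hasFDerivAt_arcHeight a hc0
  have hinv := (hasDerivAt_inv hc0).comp_hasFDerivAt 0 hcos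
  have hds : HasFDerivAt (fun θ : Fin m → ℝ => sumForm fun j => -(a j * Real.sin (θ j)))
      (∑ j, (-(a j)) • (ContinuousLinearMap.proj (R := ℝ) (φ := fun _ : Fin m => ℝ) j).smulRight
        (ContinuousLinearMap.proj (R := ℝ) (φ := fun _ : Fin m => ℝ) j)) 0 := by
    refine HasFDerivAt.fun_sum fun j _ => ?_
    have h1 := (((hasFDerivAt_apply (𝕜 := ℝ) j (0 : Fin m → ℝ)).sin).const_mul (a j)).neg
    have h2 := h1.smul_const (ContinuousLinearMap.proj (R := ℝ) (φ := fun _ : Fin m => ℝ) j)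
    refine h2.congr_fderiv ?_
    ext v w
    simp [mul_assoc]
  -- Differentiability suffices here: the derivative of this factor gets multiplied by the sine sum,
  -- which is 0 at the origin.
  have hdc : DifferentiableAt ℝ
      (fun θ : Fin m → ℝ => sumForm fun j => a j * Real.cos (θ j)) 0 := by
    refine DifferentiableAt.fun_sum fun j _ => ?_
    exact ((((hasFDerivAt_apply (𝕜 := ℝ) j (0 : Fin m → ℝ)).cos).const_mul
      (a j)).differentiableAt).smul_const _
  have hform : HasFDerivAt (arcHeightForm a b c) _ 0 :=
    ((((hasFDerivAt_sum_cos a 0).add_const b).add hτ).neg.smul hds).sub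
      ((hasFDerivAt_sum_sin a 0).smul hdc.hasFDerivAt)
  have hall := hinv.smul hform
  rw [hessianAt, ContinuousLinearMap.toBilinForm_apply, hev.fderiv_eq,
    HasFDerivAt.fderiv (f := fun θ : Fin m → ℝ =>
      (∑ j, a j * Real.cos (θ j) + b + c)⁻¹ • arcHeightForm a b c θ) hall]
  have hz : arcHeightForm a b c 0 = 0 := by ext v; simp [arcHeightForm, sumForm_apply]
  simp [hz, sumForm_apply]
  left
  ring

theorem hessianAt_arcHeight_zero_nondegenerate {m : ℕ} {a : Fin m → ℝ} {b c : ℝ}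
    (ha : ∀ j, a j ≠ 0) (h : ∑ j, a j + b + c ≠ 0) (hr : ∑ j, a j + b + arcHeight a b c 0 ≠ 0)
    (hb : b + arcHeight a b c 0 ≠ 0) : (hessianAt (arcHeight a b c) 0).Nondegenerate := by
  set r := ∑ j, a j + b + arcHeight a b c 0 with hrdef
  have hsymm : ∀ v w, hessianAt (arcHeight a b c) 0 v w = hessianAt (arcHeight a b c) 0 w v := by
    intro v w
    rw [hessianAt_arcHeight_zero a h, hessianAt_arcHeight_zero a h]
    simp only [mul_comm (v _) (w _), mul_comm (∑ j, a j * v j)]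
  have hsep : ∀ v, (∀ w, hessianAt (arcHeight a b c) 0 v w = 0) → v = 0 := by
    intro v hv
    -- Testing against basis vectors shows that all r v_k equal Σ a_j v_j. Weighting by a_k and
    -- summing gives (r - Σ a_j) Σ a_j v_j = 0, where r - Σ a_j is the quantity in `hb`.
    have hk : ∀ k, r * v k = ∑ j, a j * v j := fun k => by
      have h1 := hv (Pi.single k 1)
      rw [hessianAt_arcHeight_zero a h, ← hrdef] at h1
      have h2 := (mul_eq_zero.1 h1).resolve_left (inv_ne_zero h)
      simp only [Pi.single_apply, mul_ite, mul_one, mul_zero, Finset.sum_ite_eq',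
        Finset.mem_univ, if_true] at h2
      exact mul_left_cancel₀ (ha k) (by linarith)
    have hsum : (∑ j, a j) * (∑ j, a j * v j) = r * ∑ j, a j * v j := by
      rw [Finset.sum_mul, Finset.mul_sum]
      exact Finset.sum_congr rfl fun j _ => by rw [← hk j]; ring
    have h0 : ∑ j, a j * v j = 0 := by
      have : (b + arcHeight a b c 0) * ∑ j, a j * v j = 0 := by
        rw [hrdef] at hsum
        linarith
      exact (mul_eq_zero.1 this).resolve_left hb
    ext k
    have := hk k
    rw [h0] at this
    exact (mul_eq_zero.1 this).resolve_left hr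
  exact ⟨hsep, fun w hw => hsep w fun v => (hsymm w v).trans (hw v)⟩

/-- The hypothesis `hb` is the inequality Σ a_j < r needed for the rank one term to be harmless. -/
theorem sigNeg_hessianAt_arcHeight_zero {m : ℕ} {a : Fin m → ℝ} {b c : ℝ}
    (h : 0 < ∑ j, a j + b + c) (hr : 0 < ∑ j, a j + b + arcHeight a b c 0)
    (hb : 0 < b + arcHeight a b c 0) :
    sigNeg (hessianAt (arcHeight a b c) 0).toQuadraticMap = {j | a j < 0}.ncard := by
  refine sigNeg_diagonal_sub_sq a hr (inv_pos.2 h) (by linarith) _ fun v => ?_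
  rw [LinearMap.BilinMap.toQuadraticMap_apply, hessianAt_arcHeight_zero a h.ne']
  ring

/-! ### Angular coordinates -/

/-- The angle from `w` to `z`. -/
noncomputable def angleFrom (w z : ℂ) : ℝ := (Complex.log (z * (starRingEnd ℂ) w)).im

theorem mul_exp_mul_conj {w : ℂ} (hw : ‖w‖ = 1) (θ : ℝ) :
    w * Complex.exp (θ * Complex.I) * (starRingEnd ℂ) w = Complex.exp (θ * Complex.I) := by
  rw [mul_right_comm, Complex.mul_conj, Complex.normSq_eq_norm_sq, hw]
  simp

theorem angleFrom_mul_exp {w : ℂ} (hw : ‖w‖ = 1) {θ : ℝ} (hθ : |θ| < Real.pi) :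
    angleFrom w (w * Complex.exp (θ * Complex.I)) = θ := by
  obtain ⟨h1, h2⟩ := abs_lt.1 hθ
  rw [angleFrom, mul_exp_mul_conj hw, Complex.log_exp] <;> simp [h1, h2.le]

theorem mul_exp_mul_conj_mem_slitPlane {w : ℂ} (hw : ‖w‖ = 1) {θ : ℝ} (hθ : |θ| < Real.pi) :
    w * Complex.exp (θ * Complex.I) * (starRingEnd ℂ) w ∈ Complex.slitPlane := by
  obtain ⟨h1, h2⟩ := abs_lt.1 hθ
  rw [mul_exp_mul_conj hw, Complex.mem_slitPlane_iff_arg]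
  refine ⟨?_, Complex.exp_ne_zero _⟩
  have : Complex.arg (Complex.exp (θ * Complex.I)) = θ := by
    rw [← Complex.log_im, Complex.log_exp] <;> simp [h1, h2.le]
  rw [this]
  exact h2.ne

theorem mul_exp_angleFrom {w z : ℂ} (hw : ‖w‖ = 1) (hz : ‖z‖ = 1) :
    w * Complex.exp (angleFrom w z * Complex.I) = z := by
  have h1 : ‖z * (starRingEnd ℂ) w‖ = 1 := by rw [norm_mul, Complex.norm_conj, hw, hz, one_mul]
  have h2 : Complex.log (z * (starRingEnd ℂ) w) = angleFrom w z * Complex.I := by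
    refine Complex.ext ?_ ?_
    · simp [Complex.log_re, hw, hz]
    · simp [angleFrom]
  rw [← h2, Complex.exp_log (by rw [← norm_ne_zero_iff, h1]; exact one_ne_zero), mul_left_comm,
    Complex.mul_conj, Complex.normSq_eq_norm_sq, hw]
  simp

theorem abs_angleFrom_lt {w z : ℂ} (h : z * (starRingEnd ℂ) w ∈ Complex.slitPlane) :
    |angleFrom w z| < Real.pi := by
  rw [angleFrom, Complex.log_im]
  exact abs_lt.2 ⟨Complex.neg_pi_lt_arg _,
    lt_of_le_of_ne (Complex.arg_le_pi _) (Complex.mem_slitPlane_iff_arg.1 h).1⟩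

theorem contDiffAt_angleFrom {w z : ℂ} (h : z * (starRingEnd ℂ) w ∈ Complex.slitPlane) :
    ContDiffAt ℝ ∞ (angleFrom w) z := by
  have h1 : ContDiffAt ℝ ∞ (fun z => Complex.log (z * (starRingEnd ℂ) w)) z :=
    ((Complex.contDiffAt_log h).restrict_scalars ℝ).comp z (contDiffAt_id.mul contDiffAt_const)
  exact Complex.imCLM.contDiff.contDiffAt.comp z h1

/-- The angular parametrization of the torus centred at `w`. -/
noncomputable def torusArc {m : ℕ} (w : Fin m → ℂ) (θ : Fin m → ℝ) (j : Fin m) : ℂ :=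
  w j * Complex.exp (θ j * Complex.I)

theorem contDiff_torusArc {m : ℕ} (w : Fin m → ℂ) : ContDiff ℝ ∞ (torusArc w) := by
  refine contDiff_pi.2 fun j => contDiff_const.mul (ContDiff.cexp ?_)
  exact (Complex.ofRealCLM.contDiff.comp (contDiff_apply ℝ ℝ j)).mul contDiff_const

theorem norm_torusArc {m : ℕ} {w : Fin m → ℂ} (hw : ∀ j, ‖w j‖ = 1) (θ : Fin m → ℝ)
    (j : Fin m) : ‖torusArc w θ j‖ = 1 := by
  rw [torusArc, norm_mul, Complex.norm_exp_ofReal_mul_I, hw, one_mul]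

theorem torusArc_zero {m : ℕ} (w : Fin m → ℂ) : torusArc w 0 = w := by
  ext j
  simp [torusArc]

/-! ### The local parametrization by a graph -/

/-- The denominator of `graphHeight`. -/
noncomputable def graphDenom {m : ℕ} (ℓ : Fin (m + 2) → ℝ) (z : Fin m → ℂ) : ℝ :=
  (midSum ℓ z).re + ℓ (Fin.last (m + 1)) + ℓ 0

/-- The height at which the point `z` of the torus lies on the cobordism. -/
noncomputable def graphHeight {m : ℕ} (ℓ : Fin (m + 2) → ℝ) (z : Fin m → ℂ) : ℝ :=
  (ℓ 0 ^ 2 - ((midSum ℓ z).re + ℓ (Fin.last (m + 1))) ^ 2 - (midSum ℓ z).im ^ 2) /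
    (2 * graphDenom ℓ z)

theorem cobordismFun_eq_zero_iff_graphHeight {m : ℕ} {ℓ : Fin (m + 2) → ℝ}
    {p : (Fin m → ℂ) × ℝ} (h : graphDenom ℓ p.1 ≠ 0) :
    cobordismFun ℓ p = 0 ↔ p.2 = graphHeight ℓ p.1 := by
  rw [cobordismFun_eq, graphHeight, eq_div_iff (mul_ne_zero two_ne_zero h), graphDenom]
  constructor <;> intro h <;> linarith

theorem contDiff_graphDenom {m : ℕ} (ℓ : Fin (m + 2) → ℝ) : ContDiff ℝ ∞ (graphDenom ℓ) :=
  ((Complex.reCLM.contDiff.comp (contDiff_midSum ℓ)).add contDiff_const).add contDiff_const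

theorem contDiffOn_graphHeight {m : ℕ} (ℓ : Fin (m + 2) → ℝ) :
    ContDiffOn ℝ ∞ (graphHeight ℓ) {z | graphDenom ℓ z ≠ 0} := by
  have hre : ContDiff ℝ ∞ fun z => (midSum ℓ z).re :=
    Complex.reCLM.contDiff.comp (contDiff_midSum ℓ)
  have him : ContDiff ℝ ∞ fun z => (midSum ℓ z).im :=
    Complex.imCLM.contDiff.comp (contDiff_midSum ℓ)
  refine ContDiffOn.div (ContDiff.contDiffOn ?_)
    (contDiff_const.mul (contDiff_graphDenom ℓ)).contDiffOn fun z hz =>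
      mul_ne_zero two_ne_zero hz
  exact (contDiff_const.sub ((hre.add contDiff_const).pow 2)).sub (him.pow 2)

/-- The graph of `graphHeight` in angular coordinates. -/
noncomputable def graphParam {m : ℕ} (ℓ : Fin (m + 2) → ℝ) (w : Fin m → ℂ) (θ : Fin m → ℝ) :
    (Fin m → ℂ) × ℝ := (torusArc w θ, graphHeight ℓ (torusArc w θ))

/-- Where the coefficient of the height does not vanish, the affine equation is solved for the
height and the angles are free. Restricting to heights in the open interval removes the end
constraints, so the model is the whole space. -/
theorem isLocalParamAt_graphParam {m : ℕ} {ℓ : Fin (m + 2) → ℝ} {ε : ℝ}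
    {p : (Fin m → ℂ) × ℝ} (hp : p ∈ cobordismW ℓ ε) (ht : p.2 ∈ Set.Ioo 0 (ℓ 0 - ε))
    (hden : graphDenom ℓ p.1 ≠ 0) :
    ∃ O, IsLocalParamAt (cobordismW ℓ ε) p Set.univ O (graphParam ℓ p.1) 0 := by
  obtain ⟨hw, -, hf⟩ := hp
  have hh := (cobordismFun_eq_zero_iff_graphHeight hden).1 hf
  let U : Set (Fin m → ℝ) := {θ | graphDenom ℓ (torusArc p.1 θ) ≠ 0}
  have hU : IsOpen U :=
    isOpen_ne.preimage ((contDiff_graphDenom ℓ).comp (contDiff_torusArc p.1)).continuous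
  have hG : ContDiffOn ℝ ∞ (fun θ => graphHeight ℓ (torusArc p.1 θ)) U :=
    (contDiffOn_graphHeight ℓ).comp (contDiff_torusArc p.1).contDiffOn fun θ hθ => hθ
  let O : Set (Fin m → ℝ) := (⋂ j, {θ | |θ j| < Real.pi}) ∩
    (U ∩ (fun θ => graphHeight ℓ (torusArc p.1 θ)) ⁻¹' Set.Ioo 0 (ℓ 0 - ε))
  let V : Set ((Fin m → ℂ) × ℝ) := (⋂ j, {q | q.1 j * (starRingEnd ℂ) (p.1 j) ∈
    Complex.slitPlane}) ∩ ({q | graphDenom ℓ q.1 ≠ 0} ∩ {q | q.2 ∈ Set.Ioo 0 (ℓ 0 - ε)})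
  refine ⟨O, Or.inl rfl, ?_, ?_, ⟨V, fun q j => angleFrom (p.1 j) (q.1 j), ?_, ?_, ?_, ?_⟩, ?_, ?_⟩
  · refine IsOpen.inter (isOpen_iInter_of_finite fun j => ?_)
      (hG.continuousOn.isOpen_inter_preimage hU isOpen_Ioo)
    exact isOpen_lt (continuous_apply j).abs continuous_const
  · exact (contDiff_torusArc p.1).contDiffOn.prodMk (hG.mono fun θ hθ => hθ.2.1)
  · refine IsOpen.inter (isOpen_iInter_of_finite fun j => ?_) (IsOpen.inter ?_ ?_)
    · exact Complex.isOpen_slitPlane.preimage (by fun_prop)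
    · exact isOpen_ne.preimage ((contDiff_graphDenom ℓ).continuous.comp continuous_fst)
    · exact isOpen_Ioo.preimage continuous_snd
  · ext q
    constructor
    · rintro ⟨θ, ⟨⟨hθ, hden', hI⟩, -⟩, rfl⟩
      have hfθ : cobordismFun ℓ (graphParam ℓ p.1 θ) = 0 :=
        (cobordismFun_eq_zero_iff_graphHeight (p := graphParam ℓ p.1 θ) hden').2 rfl
      refine ⟨⟨norm_torusArc hw θ, Set.Ioo_subset_Icc_self hI, hfθ⟩, ?_, hden', hI⟩
      have hθ' : ∀ j, |θ j| < Real.pi := fun j => Set.mem_iInter.1 hθ j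
      refine Set.mem_iInter.2 fun j => ?_
      change torusArc p.1 θ j * (starRingEnd ℂ) (p.1 j) ∈ Complex.slitPlane
      rw [torusArc]
      exact mul_exp_mul_conj_mem_slitPlane (hw j) (hθ' j)
    · rintro ⟨⟨hz, -, hfq⟩, hslit, hden', hI⟩
      have harc : torusArc p.1 (fun j => angleFrom (p.1 j) (q.1 j)) = q.1 :=
        funext fun j => mul_exp_angleFrom (hw j) (hz j)
      have hq := (cobordismFun_eq_zero_iff_graphHeight hden').1 hfq
      refine ⟨fun j => angleFrom (p.1 j) (q.1 j), ⟨⟨?_, ?_, ?_⟩, trivial⟩, ?_⟩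
      · exact Set.mem_iInter.2 fun j => abs_angleFrom_lt (Set.mem_iInter.1 hslit j)
      · change graphDenom ℓ (torusArc p.1 _) ≠ 0
        rwa [harc]
      · change graphHeight ℓ (torusArc p.1 _) ∈ Set.Ioo 0 (ℓ 0 - ε)
        rwa [harc, ← hq]
      · rw [graphParam, harc, ← hq]
  · refine contDiffOn_pi.2 fun j q hq => ContDiffAt.contDiffWithinAt ?_
    have h1 := contDiffAt_angleFrom (Set.mem_iInter.1 hq.1 j)
    exact ContDiffAt.comp (f := fun q : (Fin m → ℂ) × ℝ => q.1 j) q h1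
      ((contDiff_apply ℝ ℂ j).comp contDiff_fst).contDiffAt
  · rintro θ ⟨⟨hθ, -, -⟩, -⟩
    exact funext fun j => angleFrom_mul_exp (hw j) (Set.mem_iInter.1 hθ j)
  · refine ⟨⟨Set.mem_iInter.2 fun j => ?_, ?_, ?_⟩, trivial⟩
    · change |(0 : ℝ)| < Real.pi
      rw [abs_zero]
      exact Real.pi_pos
    · change graphDenom ℓ (torusArc p.1 0) ≠ 0
      rwa [torusArc_zero]
    · change graphHeight ℓ (torusArc p.1 0) ∈ Set.Ioo 0 (ℓ 0 - ε)
      rwa [torusArc_zero, ← hh]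
  · rw [graphParam, torusArc_zero, ← hh]

/-- In angular coordinates centred at a collinear configuration, the height is `arcHeight`. -/
theorem snd_comp_graphParam {m : ℕ} (ℓ : Fin (m + 2) → ℝ) (u : Fin m → ℝ) :
    Prod.snd ∘ graphParam ℓ (fun j => (u j : ℂ)) =
      arcHeight (fun j => ℓ (mid j) * u j) (ℓ (Fin.last (m + 1))) (ℓ 0) := by
  ext θ
  have hA : ∀ j, (ℓ (mid j) : ℂ) * torusArc (fun j => (u j : ℂ)) θ j =
      ((ℓ (mid j) * u j : ℝ) : ℂ) * Complex.exp (θ j * Complex.I) := fun j => by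
    rw [torusArc, Complex.ofReal_mul, mul_assoc]
  simp only [Function.comp_apply, graphParam, graphHeight, graphDenom, midSum, arcHeight, hA,
    Complex.re_sum, Complex.im_sum, Complex.re_ofReal_mul, Complex.im_ofReal_mul,
    Complex.exp_ofReal_mul_I_re, Complex.exp_ofReal_mul_I_im]

/-! ### The local parametrization by the height and all but one angle -/

/-- The point `z` of the unit circle for which `conj C * z` has real part `a` and imaginary part of
the sign of `σ`. -/
noncomputable def circlePt (σ : ℝ) (C : ℂ) (a : ℝ) : ℂ :=
  C * (a + (σ * √(Complex.normSq C - a ^ 2) : ℝ) * Complex.I) * ((Complex.normSq C)⁻¹ : ℝ)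

theorem conj_mul_circlePt {σ : ℝ} {C : ℂ} {a : ℝ} (h : 0 < Complex.normSq C - a ^ 2) :
    (starRingEnd ℂ) C * circlePt σ C a =
      a + (σ * √(Complex.normSq C - a ^ 2) : ℝ) * Complex.I := by
  have h0 : (Complex.normSq C : ℂ) ≠ 0 := by
    have : Complex.normSq C ≠ 0 := by nlinarith [sq_nonneg a]
    exact_mod_cast this
  rw [circlePt, ← mul_assoc, ← mul_assoc, mul_comm _ C, Complex.mul_conj, Complex.ofReal_inv,
    mul_right_comm, mul_inv_cancel₀ h0, one_mul]

theorem norm_circlePt {σ : ℝ} (hσ : σ ^ 2 = 1) {C : ℂ} {a : ℝ}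
    (h : 0 < Complex.normSq C - a ^ 2) : ‖circlePt σ C a‖ = 1 := by
  have h1 := congrArg Complex.normSq (conj_mul_circlePt (σ := σ) h)
  have h0 : Complex.normSq C ≠ 0 := by nlinarith [sq_nonneg a]
  rw [Complex.normSq_mul, Complex.normSq_conj, Complex.normSq_add_mul_I, mul_pow, hσ,
    Real.sq_sqrt h.le, one_mul, add_sub_cancel] at h1
  have h2 : Complex.normSq (circlePt σ C a) = 1 := mul_left_cancel₀ h0 (by rw [h1, mul_one])
  rw [Complex.normSq_eq_norm_sq] at h2
  exact (pow_eq_one_iff_of_nonneg (norm_nonneg _) two_ne_zero).1 h2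

/-- Since |conj C · z| = |C|, the real part fixes the imaginary part up to sign, and σ records that
sign. Nonzero imaginary part means a positive discriminant, where the square root is smooth. -/
theorem circlePt_eq {σ : ℝ} (hσ : σ ^ 2 = 1) {C z : ℂ} (hz : ‖z‖ = 1)
    (h : 0 < σ * ((starRingEnd ℂ) C * z).im) :
    0 < Complex.normSq C - ((starRingEnd ℂ) C * z).re ^ 2 ∧
      circlePt σ C ((starRingEnd ℂ) C * z).re = z := by
  have h1 : Complex.normSq C - ((starRingEnd ℂ) C * z).re ^ 2 =
      (σ * ((starRingEnd ℂ) C * z).im) ^ 2 := by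
    have : Complex.normSq ((starRingEnd ℂ) C * z) = Complex.normSq C := by
      rw [Complex.normSq_mul, Complex.normSq_conj, Complex.normSq_eq_norm_sq z, hz, one_pow,
        mul_one]
    rw [← this, Complex.normSq_apply, mul_pow, hσ]
    ring
  have h2 : 0 < Complex.normSq C - ((starRingEnd ℂ) C * z).re ^ 2 := by rw [h1]; positivity
  refine ⟨h2, ?_⟩
  have hC : (starRingEnd ℂ) C ≠ 0 := by
    intro h0
    simp [h0] at h
  refine mul_left_cancel₀ hC ?_
  rw [conj_mul_circlePt h2, h1, Real.sqrt_sq h.le, ← mul_assoc, ← sq, hσ, one_mul,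
    Complex.re_add_im]

/-- The law of cosines. -/
theorem norm_add_mul_sq_eq_iff {C z : ℂ} (hz : ‖z‖ = 1) {L R : ℝ} (hL : L ≠ 0) :
    ‖C + L * z‖ ^ 2 = R ^ 2 ↔
      ((starRingEnd ℂ) C * z).re = (R ^ 2 - Complex.normSq C - L ^ 2) / (2 * L) := by
  have h1 : ‖C + L * z‖ ^ 2 =
      Complex.normSq C + L ^ 2 + 2 * L * ((starRingEnd ℂ) C * z).re := by
    have h2 : Complex.normSq z = 1 := by rw [Complex.normSq_eq_norm_sq, hz, one_pow]
    rw [Complex.normSq_apply] at h2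
    rw [Complex.sq_norm, Complex.normSq_apply, Complex.normSq_apply]
    simp only [Complex.add_re, Complex.add_im, Complex.mul_re, Complex.mul_im, Complex.ofReal_re,
      Complex.ofReal_im, Complex.conj_re, Complex.conj_im]
    linear_combination L ^ 2 * h2
  rw [h1, eq_div_iff (mul_ne_zero two_ne_zero hL)]
  constructor <;> intro h <;> linarith

/-- The sum of the sides `2, …, n` without the side `k`, at height `t`. -/
noncomputable def restSum {m : ℕ} (ℓ : Fin (m + 2) → ℝ) (k : Fin m) (p : (Fin m → ℂ) × ℝ) : ℂ :=
  ∑ j ∈ Finset.univ.erase k, (ℓ (mid j) : ℂ) * p.1 j + ((ℓ (Fin.last (m + 1)) + p.2 : ℝ) : ℂ)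

/-- The real part of `conj (restSum ℓ k p) * z_k` for `p` on the cobordism. -/
noncomputable def restRe {m : ℕ} (ℓ : Fin (m + 2) → ℝ) (k : Fin m) (p : (Fin m → ℂ) × ℝ) : ℝ :=
  ((ℓ 0 - p.2) ^ 2 - Complex.normSq (restSum ℓ k p) - ℓ (mid k) ^ 2) / (2 * ℓ (mid k))

theorem midSum_add_eq_restSum {m : ℕ} (ℓ : Fin (m + 2) → ℝ) (k : Fin m)
    (p : (Fin m → ℂ) × ℝ) : midSum ℓ p.1 + ((ℓ (Fin.last (m + 1)) + p.2 : ℝ) : ℂ) =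
      restSum ℓ k p + (ℓ (mid k) : ℂ) * p.1 k := by
  rw [midSum, restSum, ← Finset.add_sum_erase _ _ (Finset.mem_univ k)]
  ring

theorem cobordismFun_eq_zero_iff_restRe {m : ℕ} {ℓ : Fin (m + 2) → ℝ} {k : Fin m}
    (hk : ℓ (mid k) ≠ 0) {p : (Fin m → ℂ) × ℝ} (hp : ‖p.1 k‖ = 1) :
    cobordismFun ℓ p = 0 ↔
      ((starRingEnd ℂ) (restSum ℓ k p) * p.1 k).re = restRe ℓ k p := by
  rw [cobordismFun_eq_norm, midSum_add_eq_restSum ℓ k, sub_eq_zero, norm_add_mul_sq_eq_iff hp hk,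
    restRe]

/-- Side k contributes ℓ_k |z_k|², which is real, so omitting it does not affect the test for
parallelism. -/
theorem im_conj_midSum_mul {m : ℕ} (ℓ : Fin (m + 2) → ℝ) (k : Fin m) (p : (Fin m → ℂ) × ℝ) :
    ((starRingEnd ℂ) (midSum ℓ p.1 + ((ℓ (Fin.last (m + 1)) + p.2 : ℝ) : ℂ)) * p.1 k).im =
      ((starRingEnd ℂ) (restSum ℓ k p) * p.1 k).im := by
  rw [midSum_add_eq_restSum ℓ k]
  simp only [Complex.add_re, Complex.add_im, Complex.mul_re, Complex.mul_im, Complex.ofReal_re,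
      Complex.ofReal_im, Complex.conj_re, Complex.conj_im]
  ring

theorem restSum_congr {m : ℕ} (ℓ : Fin (m + 2) → ℝ) {k : Fin m} {p q : (Fin m → ℂ) × ℝ}
    (h : ∀ j, j ≠ k → p.1 j = q.1 j) (ht : p.2 = q.2) : restSum ℓ k p = restSum ℓ k q := by
  rw [restSum, restSum, ht]
  congr 1
  exact Finset.sum_congr rfl fun j hj => by rw [h j (Finset.ne_of_mem_erase hj)]

theorem restRe_congr {m : ℕ} (ℓ : Fin (m + 2) → ℝ) {k : Fin m} {p q : (Fin m → ℂ) × ℝ}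
    (h : ∀ j, j ≠ k → p.1 j = q.1 j) (ht : p.2 = q.2) : restRe ℓ k p = restRe ℓ k q := by
  rw [restRe, restRe, restSum_congr ℓ h ht, ht]

theorem contDiff_normSq : ContDiff ℝ ∞ fun z : ℂ => Complex.normSq z := by
  have h : (fun z : ℂ => Complex.normSq z) = fun z => Complex.reCLM z * Complex.reCLM z +
      Complex.imCLM z * Complex.imCLM z := funext fun z => Complex.normSq_apply z
  rw [h]
  exact (Complex.reCLM.contDiff.mul Complex.reCLM.contDiff).add
    (Complex.imCLM.contDiff.mul Complex.imCLM.contDiff)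

theorem contDiff_restSum {m : ℕ} (ℓ : Fin (m + 2) → ℝ) (k : Fin m) :
    ContDiff ℝ ∞ (restSum ℓ k) := by
  refine ContDiff.add (ContDiff.sum fun j _ => contDiff_const.mul ?_) ?_
  · exact (contDiff_apply ℝ ℂ j).comp contDiff_fst
  · exact Complex.ofRealCLM.contDiff.comp (contDiff_const.add contDiff_snd)

theorem contDiff_restRe {m : ℕ} (ℓ : Fin (m + 2) → ℝ) (k : Fin m) :
    ContDiff ℝ ∞ (restRe ℓ k) :=
  ((((contDiff_const.sub contDiff_snd).pow 2).sub
    (contDiff_normSq.comp (contDiff_restSum ℓ k))).sub contDiff_const).div_const _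

/-- `restDisc ℓ k p > 0` if the side `k` can be filled in, in two ways. -/
noncomputable def restDisc {m : ℕ} (ℓ : Fin (m + 2) → ℝ) (k : Fin m)
    (p : (Fin m → ℂ) × ℝ) : ℝ :=
  Complex.normSq (restSum ℓ k p) - restRe ℓ k p ^ 2

theorem contDiff_restDisc {m : ℕ} (ℓ : Fin (m + 2) → ℝ) (k : Fin m) :
    ContDiff ℝ ∞ (restDisc ℓ k) :=
  (contDiff_normSq.comp (contDiff_restSum ℓ k)).sub ((contDiff_restRe ℓ k).pow 2)

theorem contDiffOn_circlePt_restSum {m : ℕ} (ℓ : Fin (m + 2) → ℝ) (k : Fin m) (σ : ℝ) :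
    ContDiffOn ℝ ∞ (fun p => circlePt σ (restSum ℓ k p) (restRe ℓ k p))
      {p | 0 < restDisc ℓ k p} := by
  have hsqrt : ContDiffOn ℝ ∞ (fun p => √(restDisc ℓ k p)) {p | 0 < restDisc ℓ k p} :=
    (contDiff_restDisc ℓ k).contDiffOn.sqrt fun p hp => ne_of_gt hp
  refine ((contDiff_restSum ℓ k).contDiffOn.mul (ContDiffOn.add ?_
    (ContDiffOn.mul ?_ contDiffOn_const))).mul
      (Complex.ofRealCLM.contDiff.comp_contDiffOn (ContDiffOn.inv ?_ fun p hp => ?_))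
  · exact (Complex.ofRealCLM.contDiff.comp (contDiff_restRe ℓ k)).contDiffOn
  · exact Complex.ofRealCLM.contDiff.comp_contDiffOn (contDiffOn_const.mul hsqrt)
  · exact (contDiff_normSq.comp (contDiff_restSum ℓ k)).contDiffOn
  · have h1 : 0 < Complex.normSq (restSum ℓ k p) - restRe ℓ k p ^ 2 := hp
    nlinarith [sq_nonneg (restRe ℓ k p)]

/-- The side `k` replaced by the one that closes up the polygon. -/
noncomputable def fillSide {m : ℕ} (ℓ : Fin (m + 2) → ℝ) (k : Fin m) (σ : ℝ)
    (p : (Fin m → ℂ) × ℝ) : (Fin m → ℂ) × ℝ :=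
  (Function.update p.1 k (circlePt σ (restSum ℓ k p) (restRe ℓ k p)), p.2)

theorem restSum_fillSide {m : ℕ} (ℓ : Fin (m + 2) → ℝ) (k : Fin m) (σ : ℝ)
    (p : (Fin m → ℂ) × ℝ) : restSum ℓ k (fillSide ℓ k σ p) = restSum ℓ k p :=
  restSum_congr ℓ (fun _ hj => Function.update_of_ne hj _ _) rfl

theorem restRe_fillSide {m : ℕ} (ℓ : Fin (m + 2) → ℝ) (k : Fin m) (σ : ℝ)
    (p : (Fin m → ℂ) × ℝ) : restRe ℓ k (fillSide ℓ k σ p) = restRe ℓ k p :=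
  restRe_congr ℓ (fun _ hj => Function.update_of_ne hj _ _) rfl

theorem conj_restSum_mul_fillSide {m : ℕ} {ℓ : Fin (m + 2) → ℝ} {k : Fin m} {σ : ℝ}
    {p : (Fin m → ℂ) × ℝ} (h : 0 < restDisc ℓ k p) :
    (starRingEnd ℂ) (restSum ℓ k (fillSide ℓ k σ p)) * (fillSide ℓ k σ p).1 k =
      restRe ℓ k p + (σ * √(restDisc ℓ k p) : ℝ) * Complex.I := by
  rw [restSum_fillSide]
  simp only [fillSide, Function.update_self]
  exact conj_mul_circlePt h

theorem contDiffOn_fillSide {m : ℕ} (ℓ : Fin (m + 2) → ℝ) (k : Fin m) (σ : ℝ) :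
    ContDiffOn ℝ ∞ (fillSide ℓ k σ) {p | 0 < restDisc ℓ k p} := by
  refine ContDiffOn.prodMk (contDiffOn_pi.2 fun j => ?_) contDiff_snd.contDiffOn
  by_cases hj : j = k
  · subst hj
    simp only [Function.update_self]
    exact contDiffOn_circlePt_restSum ℓ j σ
  · simp only [Function.update_of_ne hj]
    exact ((contDiff_apply ℝ ℂ j).comp contDiff_fst).contDiffOn

/-- A point of the cobordism is recovered from its sides other than `k`. -/
theorem restDisc_pos_and_fillSide_eq {m : ℕ} {ℓ : Fin (m + 2) → ℝ} {k : Fin m}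
    (hk : ℓ (mid k) ≠ 0) {σ : ℝ} (hσ : σ ^ 2 = 1) {p q : (Fin m → ℂ) × ℝ}
    (hp : ‖p.1 k‖ = 1) (hf : cobordismFun ℓ p = 0)
    (him : 0 < σ * ((starRingEnd ℂ) (restSum ℓ k p) * p.1 k).im)
    (h : ∀ j, j ≠ k → q.1 j = p.1 j) (ht : q.2 = p.2) :
    0 < restDisc ℓ k q ∧ fillSide ℓ k σ q = p := by
  have hre := (cobordismFun_eq_zero_iff_restRe hk hp).1 hf
  obtain ⟨h1, h2⟩ := circlePt_eq hσ hp him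
  rw [hre] at h1 h2
  rw [restDisc, fillSide, restSum_congr ℓ h ht, restRe_congr ℓ h ht]
  refine ⟨h1, Prod.ext (funext fun j => ?_) ht⟩
  by_cases hj : j = k
  · subst hj
    simp only [Function.update_self]
    exact h2
  · simp only [Function.update_of_ne hj]
    exact h j hj

/-- A local parametrization of the cobordism around a point that is not collinear, one of whose
coordinates is an affine function of the height. -/
theorem exists_isLocalParamAt_slice {m : ℕ} {ℓ : Fin (m + 2) → ℝ} {ε : ℝ} {k : Fin m}
    (hk : ℓ (mid k) ≠ 0) {p : (Fin m → ℂ) × ℝ} (hp : p ∈ cobordismW ℓ ε)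
    (him : ((starRingEnd ℂ) (restSum ℓ k p) * p.1 k).im ≠ 0) {b s : ℝ} (hs : s * s = 1)
    {I : Set ℝ} (hI : IsOpen I) (hpI : p.2 ∈ I) {H : Set (Fin m → ℝ)} (hH : IsModelDomain H)
    (hHI : ∀ y : Fin m → ℝ, b + s * y k ∈ I → (y ∈ H ↔ b + s * y k ∈ Set.Icc 0 (ℓ 0 - ε))) :
    ∃ O φ x, IsLocalParamAt (cobordismW ℓ ε) p H O φ x ∧ ∀ y, (φ y).2 = b + s * y k := by
  obtain ⟨hw, htI, hf⟩ := hp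
  -- The branch of the square root on which `p` lies.
  obtain ⟨σ, hσ, hσim⟩ : ∃ σ : ℝ, σ ^ 2 = 1 ∧
      0 < σ * ((starRingEnd ℂ) (restSum ℓ k p) * p.1 k).im := by
    rcases lt_or_gt_of_ne him with h | h
    · exact ⟨-1, by norm_num, by linarith⟩
    · exact ⟨1, by norm_num, by linarith⟩
  let P : (Fin m → ℝ) → (Fin m → ℂ) × ℝ := fun y => (torusArc p.1 y, b + s * y k)
  have hP : ContDiff ℝ ∞ P := (contDiff_torusArc p.1).prodMk
    (contDiff_const.add (contDiff_const.mul (contDiff_apply ℝ ℝ k)))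
  -- The height is decoded by multiplying with s, which is its own inverse.
  let ψ : (Fin m → ℂ) × ℝ → Fin m → ℝ := fun q j =>
    if j = k then s * (q.2 - b) else angleFrom (p.1 j) (q.1 j)
  have hPψ : ∀ q : (Fin m → ℂ) × ℝ, (∀ j, ‖q.1 j‖ = 1) →
      (∀ j, j ≠ k → (P (ψ q)).1 j = q.1 j) ∧ (P (ψ q)).2 = q.2 := by
    refine fun q hq => ⟨fun j hj => ?_, ?_⟩
    · simp only [P, ψ, torusArc, if_neg hj]
      exact mul_exp_angleFrom (hw j) (hq j)
    · simp only [P, ψ, if_true, ← mul_assoc, hs]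
      ring
  let O : Set (Fin m → ℝ) := (⋂ j : {j // j ≠ k}, {y | |y j| < Real.pi}) ∩
    ({y | b + s * y k ∈ I} ∩ {y | 0 < restDisc ℓ k (P y)})
  let V : Set ((Fin m → ℂ) × ℝ) := (⋂ j : {j // j ≠ k}, {q | q.1 j * (starRingEnd ℂ) (p.1 j) ∈
    Complex.slitPlane}) ∩ ({q | q.2 ∈ I} ∩
      {q | 0 < σ * ((starRingEnd ℂ) (restSum ℓ k q) * q.1 k).im})
  have hψO : ∀ q ∈ V, q ∈ cobordismW ℓ ε → ψ q ∈ O ∩ H ∧ fillSide ℓ k σ (P (ψ q)) = q := by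
    rintro q ⟨hslit, hqI, hqim⟩ ⟨hz, hqt, hfq⟩
    obtain ⟨h1, h2⟩ := hPψ q hz
    obtain ⟨h3, h4⟩ := restDisc_pos_and_fillSide_eq hk hσ (hz k) hfq hqim h1 h2
    have h5 : b + s * ψ q k = q.2 := h2
    refine ⟨⟨⟨?_, ?_, h3⟩, (hHI _ (by rwa [h5])).2 (by rwa [h5])⟩, h4⟩
    · refine Set.mem_iInter.2 fun j => ?_
      change |ψ q j| < Real.pi
      simp only [ψ, if_neg j.2]
      exact abs_angleFrom_lt (Set.mem_iInter.1 hslit j)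
    · change b + s * ψ q k ∈ I
      rwa [h5]
  have hpV : p ∈ V := by
    refine ⟨Set.mem_iInter.2 fun j => ?_, hpI, hσim⟩
    change p.1 j * (starRingEnd ℂ) (p.1 j) ∈ Complex.slitPlane
    rw [Complex.mul_conj, Complex.normSq_eq_norm_sq, hw]
    simp
  have hψφ : ∀ y ∈ O, ψ (fillSide ℓ k σ (P y)) = y := by
    rintro y ⟨hy, -, -⟩
    ext j
    by_cases hj : j = k
    · subst hj
      simp only [ψ, if_true, fillSide, P, add_sub_cancel_left, ← mul_assoc, hs, one_mul]
    · simp only [ψ, if_neg hj, fillSide, P, Function.update_of_ne hj, torusArc]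
      exact angleFrom_mul_exp (hw j) (Set.mem_iInter.1 hy ⟨j, hj⟩)
  obtain ⟨hx1, hx2⟩ := hψO p hpV ⟨hw, htI, hf⟩
  refine ⟨O, fun y => fillSide ℓ k σ (P y), ψ p,
    ⟨hH, ?_, ?_, ⟨V, ψ, ?_, ?_, ?_, fun y hy => hψφ y hy.1⟩, hx1, hx2⟩, fun y => rfl⟩
  · refine IsOpen.inter (isOpen_iInter_of_finite fun j => ?_) (IsOpen.inter ?_ ?_)
    · exact isOpen_lt (continuous_apply _).abs continuous_const
    · exact hI.preimage (by fun_prop)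
    · exact isOpen_lt continuous_const ((contDiff_restDisc ℓ k).comp hP).continuous
  · exact (contDiffOn_fillSide ℓ k σ).comp hP.contDiffOn fun y hy => hy.2.2
  · refine IsOpen.inter (isOpen_iInter_of_finite fun j => ?_) (IsOpen.inter ?_ ?_)
    · exact Complex.isOpen_slitPlane.preimage (by fun_prop)
    · exact hI.preimage continuous_snd
    · have := (contDiff_restSum ℓ k).continuous
      exact isOpen_lt continuous_const (by fun_prop)
  · ext q
    constructor
    · rintro ⟨y, ⟨hyO, hyH⟩, rfl⟩
      obtain ⟨hy, hyI, hdisc⟩ := hyO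
      have hd : 0 < restDisc ℓ k (P y) := hdisc
      have hmul := conj_restSum_mul_fillSide (σ := σ) hd
      have hnorm : ∀ j, ‖(fillSide ℓ k σ (P y)).1 j‖ = 1 := fun j => by
        by_cases hj : j = k
        · subst hj
          simp only [fillSide, Function.update_self]
          exact norm_circlePt hσ hd
        · simp only [fillSide, Function.update_of_ne hj]
          exact norm_torusArc hw y j
      refine ⟨⟨hnorm, (hHI y hyI).1 hyH, ?_⟩, Set.mem_iInter.2 fun j => ?_, hyI, ?_⟩
      · refine (cobordismFun_eq_zero_iff_restRe hk (hnorm k)).2 ?_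
        rw [hmul, restRe_fillSide]
        simp
      · have hj : |y j| < Real.pi := Set.mem_iInter.1 hy j
        change (fillSide ℓ k σ (P y)).1 j * (starRingEnd ℂ) (p.1 j) ∈ Complex.slitPlane
        simp only [fillSide, Function.update_of_ne j.2, P, torusArc]
        exact mul_exp_mul_conj_mem_slitPlane (hw j) hj
      · change 0 < σ * ((starRingEnd ℂ) (restSum ℓ k (fillSide ℓ k σ (P y))) *
          (fillSide ℓ k σ (P y)).1 k).im
        rw [hmul]
        have : 0 < √(restDisc ℓ k (P y)) := Real.sqrt_pos.2 hd
        simpa [← mul_assoc, ← sq, hσ] using this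
    · rintro ⟨hqW, hqV⟩
      obtain ⟨h1, h2⟩ := hψO q hqV hqW
      exact ⟨ψ q, h1, h2⟩
  · refine contDiffOn_pi.2 fun j => ?_
    by_cases hj : j = k
    · simp only [ψ, if_pos hj]
      exact (contDiff_const.mul (contDiff_snd.sub contDiff_const)).contDiffOn
    · simp only [ψ, if_neg hj]
      intro q hq
      have h1 : ContDiffAt ℝ ∞ (angleFrom (p.1 j)) (q.1 j) :=
        contDiffAt_angleFrom (Set.mem_iInter.1 hq.1 ⟨j, hj⟩)
      exact (ContDiffAt.comp (f := fun q : (Fin m → ℂ) × ℝ => q.1 j) q h1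
        ((contDiff_apply ℝ ℂ j).comp contDiff_fst).contDiffAt).contDiffWithinAt

/-! ### Critical points, boundary, and the main theorem -/

/-- Around a collinear configuration, the height is `arcHeight` in a local parametrization. -/
theorem exists_isLocalParamAt_criticalConfig {m : ℕ} {ℓ : Fin (m + 2) → ℝ} {ε : ℝ}
    (hε : IsSmallEnough ℓ ε) {J : Finset (Fin m)} (hJ : J ∈ criticalSets ℓ) :
    ∃ O φ, IsLocalParamAt (cobordismW ℓ ε) (criticalConfig ℓ J) Set.univ O φ 0 ∧
      Prod.snd ∘ φ = arcHeight (fun j => ℓ (mid j) * if j ∈ J then -1 else 1)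
        (ℓ (Fin.last (m + 1))) (ℓ 0) := by
  have h0 := ((mem_criticalSets_iff ℓ J).1 hJ).1
  have hfst : (criticalConfig ℓ J).1 = fun j => ((if j ∈ J then -1 else 1 : ℝ) : ℂ) := by
    rw [criticalConfig_eq h0.ne']
  have hden : graphDenom ℓ (criticalConfig ℓ J).1 ≠ 0 := by
    rw [graphDenom, hfst, midSum_sign, Complex.ofReal_re, sub_add_cancel, add_comm]
    exact h0.ne'
  obtain ⟨O, hO⟩ := isLocalParamAt_graphParam (criticalConfig_mem_cobordismW hε hJ)
    (criticalConfig_snd_mem_Ioo hε hJ) hden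
  refine ⟨O, _, hO, ?_⟩
  rw [hfst, snd_comp_graphParam]

theorem sum_mul_sign {m : ℕ} (ℓ : Fin (m + 2) → ℝ) (J : Finset (Fin m)) :
    ∑ j, (ℓ (mid j) * if j ∈ J then -1 else 1) + ℓ (Fin.last (m + 1)) = tailSum ℓ J := by
  rw [tailSum]
  simp only [mul_comm (ℓ (mid _))]

/-- J short makes the denominator and r = (ℓ_1 + `tailSum ℓ J`) / 2 positive; {1} ∪ J long and ℓ_n >
0 make b + t positive. These are the hypotheses of the two Hessian lemmas. -/
theorem isNondegenerateCriticalPt_criticalConfig {m : ℕ} {ℓ : Fin (m + 2) → ℝ}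
    (hpos : ∀ i, 0 < ℓ i) {ε : ℝ} (hε : IsSmallEnough ℓ ε) {J : Finset (Fin m)}
    (hJ : J ∈ criticalSets ℓ) :
    IsNondegenerateCriticalPt m (cobordismW ℓ ε) Prod.snd (criticalConfig ℓ J) ∧
      HasMorseIndex m (cobordismW ℓ ε) Prod.snd (criticalConfig ℓ J) J.card := by
  obtain ⟨O, φ, hφ, hg⟩ := exists_isLocalParamAt_criticalConfig hε hJ
  obtain ⟨h1, h2⟩ := (mem_criticalSets_iff ℓ J).1 hJ
  have hval : arcHeight (fun j => ℓ (mid j) * if j ∈ J then -1 else 1)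
      (ℓ (Fin.last (m + 1))) (ℓ 0) 0 = (ℓ 0 - tailSum ℓ J) / 2 := by
    rw [← hg, Function.comp_apply, hφ.map_eq, criticalConfig_snd h1.ne']
  have hsum := sum_mul_sign ℓ J
  have hd : 0 < ∑ j, (ℓ (mid j) * if j ∈ J then -1 else 1) + ℓ (Fin.last (m + 1)) + ℓ 0 := by
    rw [hsum]; linarith
  have hr : 0 < ∑ j, (ℓ (mid j) * if j ∈ J then -1 else 1) + ℓ (Fin.last (m + 1)) +
      arcHeight (fun j => ℓ (mid j) * if j ∈ J then -1 else 1)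
        (ℓ (Fin.last (m + 1))) (ℓ 0) 0 := by
    rw [hsum, hval]; linarith
  have hb : 0 < ℓ (Fin.last (m + 1)) + arcHeight (fun j => ℓ (mid j) * if j ∈ J then -1 else 1)
      (ℓ (Fin.last (m + 1))) (ℓ 0) 0 := by
    have := hpos (Fin.last (m + 1))
    rw [hval]; linarith
  refine ⟨⟨_, O, φ, 0, hφ, ?_, ?_⟩, ⟨_, O, φ, 0, hφ, ?_, ?_⟩⟩
  · rw [hg]; exact fderiv_arcHeight_zero _ hd.ne'
  · rw [hg]
    refine hessianAt_arcHeight_zero_nondegenerate (fun j => ?_) hd.ne' hr.ne' hb.ne'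
    refine mul_ne_zero (hpos _).ne' ?_
    split_ifs <;> norm_num
  · rw [hg]; exact fderiv_arcHeight_zero _ hd.ne'
  · rw [hg, sigNeg_hessianAt_arcHeight_zero hd hr hb, ← Set.ncard_coe_finset J]
    congr 1
    ext j
    have := hpos (mid j)
    by_cases hj : j ∈ J <;> simp [hj, this, this.le]

/-- A point that is not collinear has a side that gives a local parametrization. -/
theorem exists_im_restSum_ne_zero {m : ℕ} {ℓ : Fin (m + 2) → ℝ} (hpos : ∀ i, 0 < ℓ i)
    (hgen : IsGenericLength ℓ) {ε : ℝ} (hε : 0 < ε) {p : (Fin m → ℂ) × ℝ}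
    (hp : p ∈ cobordismW ℓ ε) (hnc : p ∉ criticalConfig ℓ '' criticalSets ℓ) :
    ∃ k, ((starRingEnd ℂ) (restSum ℓ k p) * p.1 k).im ≠ 0 := by
  by_contra! h
  obtain ⟨J, hJ, he⟩ := exists_eq_criticalConfig hpos hgen hε hp fun k => by
    rw [im_conj_midSum_mul, h k]
  exact hnc ⟨J, hJ, he⟩

/-- A local parametrization around an interior point that is not collinear. -/
theorem exists_isLocalParamAt_univ {m : ℕ} {ℓ : Fin (m + 2) → ℝ} (hpos : ∀ i, 0 < ℓ i)
    (hgen : IsGenericLength ℓ) {ε : ℝ} (hε : 0 < ε) {p : (Fin m → ℂ) × ℝ}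
    (hp : p ∈ cobordismW ℓ ε) (ht : p.2 ∈ Set.Ioo 0 (ℓ 0 - ε))
    (hnc : p ∉ criticalConfig ℓ '' criticalSets ℓ) :
    ∃ (k : Fin m) (O : Set (Fin m → ℝ)) (φ : (Fin m → ℝ) → (Fin m → ℂ) × ℝ) (x : Fin m → ℝ)
      (b s : ℝ), IsLocalParamAt (cobordismW ℓ ε) p Set.univ O φ x ∧ s * s = 1 ∧
        ∀ y, (φ y).2 = b + s * y k := by
  obtain ⟨k, hk⟩ := exists_im_restSum_ne_zero hpos hgen hε hp hnc
  obtain ⟨O, φ, x, h1, h2⟩ := exists_isLocalParamAt_slice (hpos (mid k)).ne' hp hk (b := 0)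
    (s := 1) (one_mul 1) isOpen_Ioo ht (H := Set.univ) (Or.inl rfl) fun y hy =>
      ⟨fun _ => Set.Ioo_subset_Icc_self hy, fun _ => trivial⟩
  exact ⟨k, O, φ, x, 0, 1, h1, one_mul 1, h2⟩

/-- A local parametrization by a half-space around a point of the bottom or of the top. -/
theorem exists_isLocalParamAt_halfSpace {m : ℕ} {ℓ : Fin (m + 2) → ℝ} (hpos : ∀ i, 0 < ℓ i)
    (hgen : IsGenericLength ℓ) {ε : ℝ} (hε : IsSmallEnough ℓ ε) {p : (Fin m → ℂ) × ℝ}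
    (hp : p ∈ cobordismW ℓ ε) (ht : p.2 = 0 ∨ p.2 = ℓ 0 - ε) :
    ∃ (k : Fin m) (O : Set (Fin m → ℝ)) (φ : (Fin m → ℝ) → (Fin m → ℂ) × ℝ) (x : Fin m → ℝ)
      (b s : ℝ), IsLocalParamAt (cobordismW ℓ ε) p {y | 0 ≤ y k} O φ x ∧ s * s = 1 ∧
        (∀ y, (φ y).2 = b + s * y k) ∧ x k = 0 := by
  have hT : 0 < ℓ 0 - ε := sub_pos.2 hε.2.1
  have hnc : p ∉ criticalConfig ℓ '' criticalSets ℓ := by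
    rintro ⟨J, hJ, rfl⟩
    have h := criticalConfig_snd_mem_Ioo hε hJ
    rcases ht with h' | h' <;> rw [h'] at h
    · exact lt_irrefl _ h.1
    · exact lt_irrefl _ h.2
  obtain ⟨k, hk⟩ := exists_im_restSum_ne_zero hpos hgen hε.1 hp hnc
  rcases ht with ht | ht
  -- At the bottom the coordinate is t, and staying below the top level leaves only the constraint 0
  -- ≤ t.
  · obtain ⟨O, φ, x, h1, h2⟩ := exists_isLocalParamAt_slice (hpos (mid k)).ne' hp hk (b := 0)
      (s := 1) (one_mul 1) (isOpen_Iio (a := ℓ 0 - ε)) (by rw [ht]; exact hT)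
      (H := {y | 0 ≤ y k}) (Or.inr ⟨k, rfl⟩) fun y hy => by
        have hy' : 0 + 1 * y k < ℓ 0 - ε := hy
        simp only [Set.mem_ofPred_eq, Set.mem_Icc]
        constructor
        · intro h; constructor <;> linarith
        · rintro ⟨h, -⟩; linarith
    refine ⟨k, O, φ, x, 0, 1, h1, one_mul 1, h2, ?_⟩
    have := h2 x
    rw [h1.map_eq, ht] at this
    linarith
  -- At the top the coordinate is the distance ℓ_1 - ε - t to the top level, so the height is
  -- reversed by s = -1.
  · obtain ⟨O, φ, x, h1, h2⟩ := exists_isLocalParamAt_slice (hpos (mid k)).ne' hp hk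
      (b := ℓ 0 - ε) (s := -1) (by norm_num) (isOpen_Ioi (a := (0 : ℝ))) (by rw [ht]; exact hT)
      (H := {y | 0 ≤ y k}) (Or.inr ⟨k, rfl⟩) fun y hy => by
        have hy' : 0 < ℓ 0 - ε + -1 * y k := hy
        simp only [Set.mem_ofPred_eq, Set.mem_Icc]
        constructor
        · intro h; constructor <;> linarith
        · rintro ⟨-, h⟩; linarith
    refine ⟨k, O, φ, x, ℓ 0 - ε, -1, h1, by norm_num, h2, ?_⟩
    have := h2 x
    rw [h1.map_eq, ht] at this
    linarith

theorem fderiv_snd_comp_ne_zero {E : Type*} {m : ℕ} {φ : (Fin m → ℝ) → E × ℝ}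
    {k : Fin m} {b s : ℝ} (hs : s * s = 1) (h : ∀ y, (φ y).2 = b + s * y k) (x : Fin m → ℝ) :
    fderiv ℝ (Prod.snd ∘ φ) x ≠ 0 := by
  intro h0
  have hd : HasFDerivAt (Prod.snd ∘ φ)
      (s • ContinuousLinearMap.proj (R := ℝ) (φ := fun _ : Fin m => ℝ) k) x := by
    have he : Prod.snd ∘ φ = fun y => b + s * y k := funext h
    rw [he]
    exact ((hasFDerivAt_apply (𝕜 := ℝ) k x).const_mul s).const_add b
  rw [hd.fderiv] at h0
  have h1 := DFunLike.congr_fun h0 (Pi.single k 1)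
  simp at h1
  simp [h1] at hs

theorem mem_Ioo_or_eq_of_mem_Icc {a b t : ℝ} (h : t ∈ Set.Icc a b) :
    t ∈ Set.Ioo a b ∨ t = a ∨ t = b := by
  rcases h.1.eq_or_lt with h1 | h1
  · exact Or.inr (Or.inl h1.symm)
  · rcases h.2.eq_or_lt with h2 | h2
    · exact Or.inr (Or.inr h2)
    · exact Or.inl ⟨h1, h2⟩

/-- Away from the q_J there is a chart in which the height is a coordinate up to sign and a
constant; its differential is nonzero there, hence in every chart. -/
theorem isCriticalPt_cobordismW_iff {m : ℕ} {ℓ : Fin (m + 2) → ℝ} (hpos : ∀ i, 0 < ℓ i)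
    (hgen : IsGenericLength ℓ) {ε : ℝ} (hε : IsSmallEnough ℓ ε) (p : (Fin m → ℂ) × ℝ) :
    IsCriticalPt m (cobordismW ℓ ε) Prod.snd p ↔ p ∈ criticalConfig ℓ '' criticalSets ℓ := by
  constructor
  · intro hc
    have hp : p ∈ cobordismW ℓ ε := by
      obtain ⟨H, O, φ, x, h, -⟩ := hc
      exact h.mem_set
    by_contra hnc
    rcases mem_Ioo_or_eq_of_mem_Icc hp.2.1 with ht | ht
    · obtain ⟨k, O, φ, x, b, s, h, hs, hφ⟩ :=
        exists_isLocalParamAt_univ hpos hgen hε.1 hp ht hnc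
      exact fderiv_snd_comp_ne_zero hs hφ x (h.fderiv_comp_eq_zero differentiableAt_snd hc)
    · obtain ⟨k, O, φ, x, b, s, h, hs, hφ, -⟩ :=
        exists_isLocalParamAt_halfSpace hpos hgen hε hp ht
      exact fderiv_snd_comp_ne_zero hs hφ x (h.fderiv_comp_eq_zero differentiableAt_snd hc)
  · rintro ⟨J, hJ, rfl⟩
    obtain ⟨H, O, φ, x, h, hz, -⟩ :=
      (isNondegenerateCriticalPt_criticalConfig hpos hε hJ).1
    exact ⟨H, O, φ, x, h, hz⟩

theorem exists_isLocalParamAt_univ_of_mem_Ioo {m : ℕ} {ℓ : Fin (m + 2) → ℝ}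
    (hpos : ∀ i, 0 < ℓ i) (hgen : IsGenericLength ℓ) {ε : ℝ} (hε : IsSmallEnough ℓ ε)
    {p : (Fin m → ℂ) × ℝ} (hp : p ∈ cobordismW ℓ ε) (ht : p.2 ∈ Set.Ioo 0 (ℓ 0 - ε)) :
    ∃ (O : Set (Fin m → ℝ)) (φ : (Fin m → ℝ) → (Fin m → ℂ) × ℝ) (x : Fin m → ℝ),
      IsLocalParamAt (cobordismW ℓ ε) p Set.univ O φ x := by
  by_cases hnc : p ∈ criticalConfig ℓ '' criticalSets ℓ
  · obtain ⟨J, hJ, rfl⟩ := hnc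
    obtain ⟨O, φ, hφ, -⟩ := exists_isLocalParamAt_criticalConfig hε hJ
    exact ⟨O, φ, 0, hφ⟩
  · obtain ⟨k, O, φ, x, b, s, h, -, -⟩ :=
      exists_isLocalParamAt_univ hpos hgen hε.1 hp ht hnc
    exact ⟨O, φ, x, h⟩

/-- Points at intermediate heights have a chart modelled on the whole space, which invariance of the
boundary makes incompatible with being a boundary point; points at the end levels have half-space
charts. -/
theorem mem_manifoldBoundary_cobordismW_iff {m : ℕ} {ℓ : Fin (m + 2) → ℝ}
    (hpos : ∀ i, 0 < ℓ i) (hgen : IsGenericLength ℓ) {ε : ℝ} (hε : IsSmallEnough ℓ ε)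
    (p : (Fin m → ℂ) × ℝ) : p ∈ manifoldBoundary m (cobordismW ℓ ε) ↔
      p ∈ cobordismW ℓ ε ∧ (p.2 = 0 ∨ p.2 = ℓ 0 - ε) := by
  constructor
  · intro hb
    have hp : p ∈ cobordismW ℓ ε := by
      obtain ⟨i, O, φ, x, h, -⟩ := hb
      exact h.mem_set
    refine ⟨hp, (mem_Ioo_or_eq_of_mem_Icc hp.2.1).resolve_left fun ht => ?_⟩
    obtain ⟨O, φ, x, h⟩ := exists_isLocalParamAt_univ_of_mem_Ioo hpos hgen hε hp ht
    exact h.notMem_manifoldBoundary hb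
  · rintro ⟨hp, ht⟩
    obtain ⟨k, O, φ, x, b, s, h, -, -, hx⟩ :=
      exists_isLocalParamAt_halfSpace hpos hgen hε hp ht
    exact ⟨k, O, φ, x, h, hx⟩

theorem isSmoothSubmanifold_cobordismW {m : ℕ} {ℓ : Fin (m + 2) → ℝ}
    (hpos : ∀ i, 0 < ℓ i) (hgen : IsGenericLength ℓ) {ε : ℝ} (hε : IsSmallEnough ℓ ε) :
    IsSmoothSubmanifold m (cobordismW ℓ ε) := by
  intro p hp
  rcases mem_Ioo_or_eq_of_mem_Icc hp.2.1 with ht | ht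
  · obtain ⟨O, φ, x, h⟩ := exists_isLocalParamAt_univ_of_mem_Ioo hpos hgen hε hp ht
    exact ⟨_, O, φ, x, h⟩
  · obtain ⟨k, O, φ, x, b, s, h, -⟩ := exists_isLocalParamAt_halfSpace hpos hgen hε hp ht
    exact ⟨_, O, φ, x, h⟩

theorem isMorseFunction_snd {m : ℕ} {ℓ : Fin (m + 2) → ℝ} (hpos : ∀ i, 0 < ℓ i)
    (hgen : IsGenericLength ℓ) {ε : ℝ} (hε : IsSmallEnough ℓ ε) :
    IsMorseFunction m (cobordismW ℓ ε) (polygonSlice ℓ 0) (polygonSlice ℓ (ℓ 0 - ε))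
      Prod.snd 0 (ℓ 0 - ε) := by
  have hT : 0 < ℓ 0 - ε := sub_pos.2 hε.2.1
  have h0 := inter_preimage_snd_eq_polygonSlice (ℓ := ℓ) hε.1 (Set.left_mem_Icc.2 hT.le)
  have h1 := inter_preimage_snd_eq_polygonSlice (ℓ := ℓ) hε.1 (Set.right_mem_Icc.2 hT.le)
  refine ⟨⟨isCompact_cobordismW ℓ ε, isSmoothSubmanifold_cobordismW hpos hgen hε, ?_, ?_⟩,
    ⟨Set.univ, isOpen_univ, Set.subset_univ _, contDiff_snd.contDiffOn⟩, fun p hp => hp.2.1,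
    h0, h1, ?_, ?_⟩
  · ext p
    rw [mem_manifoldBoundary_cobordismW_iff hpos hgen hε, ← h0, ← h1,
      ← Set.inter_union_distrib_left]
    rfl
  · rw [← h0, ← h1]
    refine Set.disjoint_left.2 fun p hp hp' => ?_
    exact hT.ne ((hp.2 : p.2 = 0).symm.trans hp'.2)
  · intro p hc hb
    obtain ⟨J, hJ, rfl⟩ := (isCriticalPt_cobordismW_iff hpos hgen hε p).1 hc
    have ht := criticalConfig_snd_mem_Ioo hε hJ
    rcases ((mem_manifoldBoundary_cobordismW_iff hpos hgen hε _).1 hb).2 with h | h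
    · exact ht.1.ne' h
    · exact ht.2.ne h
  · intro p hc
    obtain ⟨J, hJ, rfl⟩ := (isCriticalPt_cobordismW_iff hpos hgen hε p).1 hc
    exact (isNondegenerateCriticalPt_criticalConfig hpos hε hJ).1

theorem shiftLength_zero_right {m : ℕ} (ℓ : Fin (m + 2) → ℝ) : shiftLength ℓ 0 = ℓ := by
  ext i
  rw [shiftLength]
  split_ifs with h h' <;> simp [*]

theorem mainTheorem12 (m : ℕ) (ℓ : Fin (m + 2) → ℝ) (hpos : ∀ i, 0 < ℓ i)
    (hord : Monotone ℓ) (hgen : IsGenericLength ℓ) :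
    (∃ ε₀ > 0, ∀ ε, 0 < ε → ε < ε₀ → IsSmallEnough ℓ ε) ∧
    ∀ ε, IsSmallEnough ℓ ε →
      (AreDiffeomorphic (polygonSpace ℓ) (polygonSlice ℓ 0) ∧
        AreDiffeomorphic (polygonSpace (shiftLength ℓ (ℓ 0 - ε))) (polygonSlice ℓ (ℓ 0 - ε))) ∧
      IsMorseFunction m (cobordismW ℓ ε) (polygonSlice ℓ 0) (polygonSlice ℓ (ℓ 0 - ε))
        Prod.snd 0 (ℓ 0 - ε) ∧
      Set.BijOn (criticalConfig ℓ) (criticalSets ℓ)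
        {p | IsCriticalPt m (cobordismW ℓ ε) Prod.snd p} ∧
      ∀ J ∈ criticalSets ℓ,
        ∑ i : Fin (m + 2), signOf J i * ℓ i ≠ 0 ∧
        2 * (criticalConfig ℓ J).2 * ∑ i : Fin (m + 2), signOf J i * ℓ i =
          ℓ 0 ^ 2 - (∑ i : Fin (m + 1), signOf J i.succ * ℓ i.succ) ^ 2 ∧
        HasMorseIndex m (cobordismW ℓ ε) Prod.snd (criticalConfig ℓ J) J.card := by
  refine ⟨hgen.exists_isSmallEnough (hpos 0), fun ε hε => ⟨⟨?_, ?_⟩,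
    isMorseFunction_snd hpos hgen hε, ⟨?_, (criticalConfig_injective ℓ).injOn, ?_⟩,
    fun J hJ => ?_⟩⟩
  · have h := areDiffeomorphic_polygonSlice (ℓ := ℓ) (t := 0) (by simpa using (hpos 0).ne')
    rwa [shiftLength_zero_right] at h
  · exact areDiffeomorphic_polygonSlice (by simpa using hε.1.ne')
  · exact fun J hJ => (isCriticalPt_cobordismW_iff hpos hgen hε _).2 ⟨J, hJ, rfl⟩
  · exact fun p hp => (isCriticalPt_cobordismW_iff hpos hgen hε p).1 hp
  · have h0 := ((mem_criticalSets_iff ℓ J).1 hJ).1.ne'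
    rw [sum_signOf, sum_signOf_succ, criticalConfig_snd h0]
    exact ⟨h0, by ring, (isNondegenerateCriticalPt_criticalConfig hpos hε hJ).2⟩
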